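/- **Proposition A.1** (list-decodable mean estimation when $\alpha^{-1}=\Omega(d)$). Let $d,n\ge 1$, let $T=\{X_1,\dots,X_n\}$ be points of $\mathbb{R}^d$ (repetitions allowed), $\alpha\in(0,\tfrac12]$ and $\mu^*\in\mathbb{R}^d$, and suppose that there is $S\subseteq[n]$ with $|S|\ge\alpha n$ and $$\frac1{|S|}\sum_{i\in S}(X_i-\mu^*)(X_i-\mu^*)^\top\preceq \mathbf I .$$ Let $\delta\in(0,1)$. The algorithm $\mathsf{SamplePostProcess}$, with a constant parameter $K\in\mathbb N$, does the following. 1. Set $N=\lceil 36\log(2/\delta)/\alpha\rceil$ and draw $\widetilde X_1,\dots,\widetilde X_N$ independently and uniformly from $T$. 2. Set $c=\lceil K\log(1/(\alpha\delta))\rceil$ and draw $\mathbf G\in\mathbb{R}^{d\times c}$ with independent entries, uniform on $\{\pm 1/\sqrt c\}$. 3. Greedily compute and return a maximal set $L\subseteq[N]$ (standing for the points $\widetilde X_i$, $i\in L$) such that for each $i\in L$: $\|\mathbf G^\top(\widetilde X_i-\widetilde X_j)\|_2^2\le 8.8\,d$ for at least $\alpha N/3$ of the $j\in[N]$, and $\|\mathbf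 G^\top(\widetilde X_i-\widetilde X_j)\|_2^2> 35.2\,d$ for all $j\in L$, $j\neq i$. There is a universal constant $K_0$ such that for every constant $C>0$ there is a constant $A$ depending only on $C$, and for every $K\ge K_0$ a constant $B$ depending only on $C$ and $K$, such that whenever $\alpha\le\frac1{Cd}$: * in every execution the algorithm returns a maximal set as in step 3, every such maximal set $L$ satisfies $|L|\le 3/\alpha$, and the number of steps executed on a real RAM (unit-cost real arithmetic, comparison, square root, logarithm, rounding up, reading of an input coordinate, uniform sampling of an index in $[n]$, and coin flips) is at most $$B\cdot\frac{1}{\alpha^2}\log^4\!\Big(\frac1{\alpha\delta}\Big);$$ * with probability at least $1-\delta$ over the random choices of steps 1 and 2, every maximal set $L$ as in step 3 (in particular the returned one) satisfies $$\min_{i\in L}\|\widetilde X_i-\mu^*\|_2\le \frac{A}{\sqrt\alpha}.$$ -/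

import Mathlib

/-! ## Randomised real RAM programs with unit-cost instructions -/

/-- Binary arithmetic instructions on real registers. -/
inductive BinOp where
  | add
  | sub
  | mul
  | div

/-- Unary instructions on real registers. -/
inductive UnOp where
  | sqrt
  | log

/-- Programs of a randomised real RAM, as instruction trees. `R` is the type of register contents,
the input is an array of `n` points with `d` coordinates each, and `A` is the type of the result.
A program is written for an arbitrary type `R`, so it can handle register contents only through
the instructions below; its continuation `k` receives the result of the instruction. -/
inductive Prog (R : Type) (n d : ℕ) (A : Type) : Type where
  /-- Halt with a result (free of charge). -/
  | ret (a : A) : Prog R n d A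
  /-- One step of control or bookkeeping: an iteration of a loop, a write to a Boolean array. -/
  | step (k : Unit → Prog R n d A) : Prog R n d A
  /-- Load a rational constant. -/
  | const (q : ℚ) (k : R → Prog R n d A) : Prog R n d A
  /-- Convert an integer (an input size or a loop bound) to a real register. -/
  | ofNat (m : ℕ) (k : R → Prog R n d A) : Prog R n d A
  /-- Binary arithmetic. -/
  | bin (o : BinOp) (x y : R) (k : R → Prog R n d A) : Prog R n d A
  /-- Square root or natural logarithm. -/
  | un (o : UnOp) (x : R) (k : R → Prog R n d A) : Prog R n d A
  /-- The comparison `x ≤ y`. -/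
  | le (x y : R) (k : Bool → Prog R n d A) : Prog R n d A
  /-- Round up to a natural number (to be used as a loop bound). -/
  | ceil (x : R) (k : ℕ → Prog R n d A) : Prog R n d A
  /-- Read coordinate `j` of input point `i`. -/
  | read (i : Fin n) (j : Fin d) (k : R → Prog R n d A) : Prog R n d A
  /-- Draw a fresh uniformly random index of an input point. -/
  | sample (k : Fin n → Prog R n d A) : Prog R n d A
  /-- Flip a fresh fair coin. -/
  | coin (k : Bool → Prog R n d A) : Prog R n d A

namespace Prog

variable {R : Type} {n d : ℕ} {A B : Type}

/-- Sequential composition. -/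
def bind : Prog R n d A → (A → Prog R n d B) → Prog R n d B
  | ret a, f => f a
  | step k, f => step fun u => (k u).bind f
  | const q k, f => const q fun x => (k x).bind f
  | ofNat m k, f => ofNat m fun x => (k x).bind f
  | bin o x y k, f => bin o x y fun z => (k z).bind f
  | un o x k, f => un o x fun z => (k z).bind f
  | le x y k, f => le x y fun b => (k b).bind f
  | ceil x k, f => ceil x fun m => (k m).bind f
  | read i j k, f => read i j fun x => (k x).bind f
  | sample k, f => sample fun i => (k i).bind f
  | coin k, f => coin fun b => (k b).bind f

instance instMonad : Monad (Prog R n d) where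
  pure := ret
  bind := bind

end Prog

/-- The value of a binary instruction. -/
noncomputable def BinOp.eval : BinOp → ℝ → ℝ → ℝ
  | add, x, y => x + y
  | sub, x, y => x - y
  | mul, x, y => x * y
  | div, x, y => x / y

/-- The value of a unary instruction. -/
noncomputable def UnOp.eval : UnOp → ℝ → ℝ
  | sqrt, x => Real.sqrt x
  | log, x => Real.log x

/-- Charge one step. -/
noncomputable def chargeStep {A : Type} (p : PMF (A × ℕ)) : PMF (A × ℕ) :=
  p.map fun o => (o.1, o.2 + 1)

open Classical in
/-- Execution of a program on the input points `X`: the joint law of the result and of the number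
of executed instructions. Every instruction costs one step. -/
noncomputable def Prog.exec {n d : ℕ} [NeZero n] {A : Type}
    (X : Fin n → EuclideanSpace ℝ (Fin d)) : Prog ℝ n d A → PMF (A × ℕ)
  | ret a => PMF.pure (a, 0)
  | step k => chargeStep ((k ()).exec X)
  | const q k => chargeStep ((k (q : ℝ)).exec X)
  | ofNat m k => chargeStep ((k (m : ℝ)).exec X)
  | bin o x y k => chargeStep ((k (o.eval x y)).exec X)
  | un o x k => chargeStep ((k (o.eval x)).exec X)
  | le x y k => chargeStep ((k (decide (x ≤ y))).exec X)
  | ceil x k => chargeStep ((k ⌈x⌉₊).exec X)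
  | read i j k => chargeStep ((k (X i j)).exec X)
  | sample k => (PMF.uniformOfFintype (Fin n)).bind fun i => chargeStep ((k i).exec X)
  | coin k => (PMF.uniformOfFintype Bool).bind fun b => chargeStep ((k b).exec X)

namespace Prog

variable {R : Type} {n d : ℕ} {A : Type}

/-! ### Single instructions and loops -/

/-- One bookkeeping step. -/
def tick : Prog R n d Unit := step ret

/-- Binary arithmetic as a program. -/
def arith (o : BinOp) (x y : R) : Prog R n d R := bin o x y ret

/-- Fill an array of length `m`, cell by cell, one extra step for every cell. -/
def tabulate : (m : ℕ) → (Fin m → Prog R n d A) → Prog R n d (Fin m → A)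
  | 0, _ => pure Fin.elim0
  | m + 1, f => do
      tick
      let a ← f 0
      let v ← tabulate m fun i => f i.succ
      pure (Fin.cons a v)

/-- The loop `for i = 0, …, m - 1 do s ← f i s`, one extra step for every iteration. -/
def loop : (m : ℕ) → (Fin m → A → Prog R n d A) → A → Prog R n d A
  | 0, _, s => pure s
  | m + 1, f, s => do
      tick
      let t ← f 0 s
      loop m (fun i => f i.succ) t

/-! ### The algorithm -/

/-- Draw a uniformly random input point and copy it. -/
def samplePoint : Prog R n d (Fin d → R) := do
  let i ← sample ret
  tabulate d fun j => read i j ret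

/-- A `d × c` matrix of independent uniformly random signs, scaled by `1 / √c`. -/
def signMatrix (c : ℕ) : Prog R n d (Fin d → Fin c → R) := do
  let cc ← ofNat c ret
  let s ← un .sqrt cc ret
  let one ← const 1 ret
  let zero ← const 0 ret
  let pos ← arith .div one s
  let neg ← arith .sub zero pos
  tabulate d fun _ => tabulate c fun _ => do
    let b ← coin ret
    pure (if b then pos else neg)

/-- The product `Gᵀ x`. -/
def project {c : ℕ} (G : Fin d → Fin c → R) (x : Fin d → R) : Prog R n d (Fin c → R) :=
  tabulate c fun k => do
    let zero ← const 0 ret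
    loop d (fun j acc => do
      let p ← arith .mul (G j k) (x j)
      arith .add acc p) zero

/-- The squared Euclidean distance of two vectors. -/
def sqDist {c : ℕ} (u v : Fin c → R) : Prog R n d R := do
  let zero ← const 0 ret
  loop c (fun k acc => do
    let t ← arith .sub (u k) (v k)
    let p ← arith .mul t t
    arith .add acc p) zero

/-- The number (in a real register) of the vectors `y j` at squared distance at most `r`
from `y i`. -/
def countClose {N c : ℕ} (y : Fin N → Fin c → R) (r : R) (i : Fin N) : Prog R n d R := do
  let zero ← const 0 ret
  let one ← const 1 ret
  loop N (fun j cnt => do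
    let s ← sqDist (y i) (y j)
    let b ← le s r ret
    if b then arith .add cnt one else pure cnt) zero

/-- Test whether `y i` has squared distance more than `r` from all `y j` with `sel j = true`. -/
def isSeparated {N c : ℕ} (y : Fin N → Fin c → R) (r : R) (sel : Fin N → Bool) (i : Fin N) :
    Prog R n d Bool :=
  loop N (fun j ok =>
    if sel j then do
      let s ← sqDist (y i) (y j)
      let b ← le s r ret
      pure (ok && !b)
    else pure ok) true

/-- Greedy clustering: run through the indices `i` and select `i` if at least `thr` of the vectors
are at squared distance at most `rIn` from `y i` and all the vectors selected before are at squared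
distance more than `rOut`. The result is the indicator of the selected indices. -/
def greedyCluster {N c : ℕ} (y : Fin N → Fin c → R) (thr rIn rOut : R) :
    Prog R n d (Fin N → Bool) :=
  loop N (fun i sel => do
    let cnt ← countClose y rIn i
    let dense ← le thr cnt ret
    let sep ← isSeparated y rOut sel i
    if dense && sep then do
      tick
      pure (Function.update sel i true)
    else pure sel) fun _ => false

/-- `⌈36 log(2 / δ) / α⌉`. -/
def sampleCount (α δ : R) : Prog R n d ℕ := do
  let two ← const 2 ret
  let q ← arith .div two δ
  let l ← un .log q ret
  let t ← const 36 ret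
  let p ← arith .mul t l
  let r ← arith .div p α
  ceil r ret

/-- `⌈K log(1 / (α δ))⌉`. -/
def sketchDim (K : ℕ) (α δ : R) : Prog R n d ℕ := do
  let one ← const 1 ret
  let m ← arith .mul α δ
  let q ← arith .div one m
  let l ← un .log q ret
  let t ← ofNat K ret
  let p ← arith .mul t l
  ceil p ret

end Prog

/-- What an execution of the algorithm leaves in memory: the sampled points, the projection matrix,
and the indicator of the returned subset of the sampled points. -/
structure Outcome (R : Type) (d : ℕ) where
  /-- Number of sampled points. -/
  N : ℕ
  /-- Dimension after the projection. -/
  c : ℕ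
  /-- The sampled points. -/
  pts : Fin N → Fin d → R
  /-- The random matrix. -/
  G : Matrix (Fin d) (Fin c) R
  /-- Indicator of the indices of the returned points. -/
  sel : Fin N → Bool

/-- `SamplePostProcess`, with projection dimension `⌈K log(1 / (α δ))⌉`. -/
def samplePostProcess {R : Type} {n d : ℕ} (K : ℕ) (α δ : R) : Prog R n d (Outcome R d) := do
  let N ← Prog.sampleCount α δ
  let pts ← Prog.tabulate N fun _ => Prog.samplePoint
  let c ← Prog.sketchDim K α δ
  let G ← Prog.signMatrix c
  let y ← Prog.tabulate N fun i => Prog.project G (pts i)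
  let dd ← Prog.ofNat d Prog.ret
  let a ← Prog.const (88 / 10) Prog.ret
  let rIn ← Prog.arith .mul a dd
  let b ← Prog.const (352 / 10) Prog.ret
  let rOut ← Prog.arith .mul b dd
  let NN ← Prog.ofNat N Prog.ret
  let p ← Prog.arith .mul α NN
  let three ← Prog.const 3 Prog.ret
  let thr ← Prog.arith .div p three
  let sel ← Prog.greedyCluster y thr rIn rOut
  pure ⟨N, c, pts, G, sel⟩

namespace Outcome

variable {d : ℕ}

/-- `‖Gᵀ (X_i - X_j)‖₂²` for the sampled points `X_i`, `X_j`. -/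
noncomputable def projSqDist (o : Outcome ℝ d) (i j : Fin o.N) : ℝ :=
  ‖(WithLp.toLp 2 (Matrix.mulVec o.G.transpose (o.pts i - o.pts j)) :
    EuclideanSpace ℝ (Fin o.c))‖ ^ 2

open Classical in
/-- The condition on the returned set `L`: every point of `L` is close, after projection, to at
least `α N / 3` of the sampled points, and distinct members of `L` are far apart after
projection. -/
def IsClusterSet (α : ℝ) (o : Outcome ℝ d) (L : Finset (Fin o.N)) : Prop :=
  ∀ i ∈ L,
    α * o.N / 3 ≤ ((Finset.univ.filter fun j => o.projSqDist i j ≤ 8.8 * d).card : ℝ) ∧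
    ∀ j ∈ L, j ≠ i → 35.2 * d < o.projSqDist i j

/-- The set of indices of the returned points. -/
def returned (o : Outcome ℝ d) : Finset (Fin o.N) :=
  Finset.univ.filter fun i => o.sel i = true

end Outcome

/-- At least a fraction `α` of the points `X` has second moment matrix about `μ` bounded by the
identity in the Loewner order. -/
def HasInliers {n d : ℕ} (X : Fin n → EuclideanSpace ℝ (Fin d)) (α : ℝ)
    (μ : EuclideanSpace ℝ (Fin d)) : Prop :=
  ∃ S : Finset (Fin n), α * n ≤ S.card ∧
    ((1 : Matrix (Fin d) (Fin d) ℝ) -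
      (S.card : ℝ)⁻¹ • ∑ i ∈ S, Matrix.vecMulVec (X i - μ).ofLp (X i - μ).ofLp).PosSemidef

/-! At least half of the inliers lie within `√(2d)` of `μ`, because the trace of their second moment
matrix is at most `d`. By a Chernoff bound, with high probability at least `αN/3` of the samples
then lie within `√(2d)` of `μ`, and by the Johnson–Lindenstrauss lemma the sketch changes the
squared distances between samples by at most 10%. Hence a sample near `μ` passes the density test
of the algorithm, and maximality gives a selected sample whose projection is close to that of the
former: this selected sample is at distance `O(√d) = O(1/√α)` from `μ`. The projected
neighbourhoods of the selected samples are disjoint and each contains a fraction `α/3` of the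
samples, so at most `3/α` samples are selected. -/

open MeasureTheory ProbabilityTheory Finset
open scoped NNReal ENNReal

/-! ### Concentration inequalities -/

theorem exp_neg_le_one_sub_add_sq_div_two {t : ℝ} (ht : 0 ≤ t) :
    Real.exp (-t) ≤ 1 - t + t ^ 2 / 2 := by
  have hexp := Real.quadratic_le_exp_of_nonneg ht
  have hprod : 1 ≤ (1 - t + t ^ 2 / 2) * (1 + t + t ^ 2 / 2) := by nlinarith [sq_nonneg (t ^ 2)]
  have hpos : 0 ≤ 1 - t + t ^ 2 / 2 := by nlinarith [sq_nonneg (t - 1)]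
  rw [Real.exp_neg, inv_le_iff_one_le_mul₀ (Real.exp_pos t)]
  exact hprod.trans (mul_le_mul_of_nonneg_left hexp hpos)

section Concentration

variable {Ω ι κ : Type*} {mΩ : MeasurableSpace Ω} {μ : Measure Ω}

theorem integrable_exp_neg_mul_of_nonneg [IsFiniteMeasure μ] {Y : Ω → ℝ} {t : ℝ}
    (hm : AEMeasurable Y μ) (h0 : 0 ≤ᵐ[μ] Y) (ht : 0 ≤ t) :
    Integrable (fun ω => Real.exp (-t * Y ω)) μ := by
  refine (integrable_const (1 : ℝ)).mono' (hm.const_mul (-t)).exp.aestronglyMeasurable ?_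
  filter_upwards [h0] with ω hω
  rw [Real.norm_eq_abs, Real.abs_exp, Real.exp_le_one_iff]
  exact mul_nonpos_of_nonpos_of_nonneg (neg_nonpos.2 ht) hω

theorem mgf_neg_le_of_nonneg [IsProbabilityMeasure μ] {Y : Ω → ℝ} {t : ℝ} (hY : MemLp Y 2 μ)
    (h0 : 0 ≤ᵐ[μ] Y) (ht : 0 ≤ t) :
    mgf Y μ (-t) ≤ Real.exp (-t * μ[Y] + t ^ 2 / 2 * ∫ ω, Y ω ^ 2 ∂μ) := by
  have hY1 : Integrable Y μ := hY.integrable (by norm_num)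
  have hY2 : Integrable (fun ω => Y ω ^ 2) μ := hY.integrable_sq
  have hsub : Integrable (fun ω => 1 - t * Y ω) μ := (integrable_const 1).sub (hY1.const_mul t)
  calc mgf Y μ (-t) ≤ ∫ ω, (1 - t * Y ω) + t ^ 2 / 2 * Y ω ^ 2 ∂μ := by
        refine integral_mono_ae (integrable_exp_neg_mul_of_nonneg hY1.aemeasurable h0 ht)
          (hsub.add (hY2.const_mul _)) ?_
        filter_upwards [h0] with ω hω
        calc Real.exp (-t * Y ω) = Real.exp (-(t * Y ω)) := by rw [neg_mul]
          _ ≤ 1 - t * Y ω + (t * Y ω) ^ 2 / 2 :=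
            exp_neg_le_one_sub_add_sq_div_two (mul_nonneg ht hω)
          _ = 1 - t * Y ω + t ^ 2 / 2 * Y ω ^ 2 := by ring
    _ = 1 - t * μ[Y] + t ^ 2 / 2 * ∫ ω, Y ω ^ 2 ∂μ := by
        rw [integral_add hsub (hY2.const_mul _), integral_sub (integrable_const 1)
          (hY1.const_mul t), integral_const_mul, integral_const_mul, integral_const,
          probReal_univ, one_smul]
    _ ≤ Real.exp (-t * μ[Y] + t ^ 2 / 2 * ∫ ω, Y ω ^ 2 ∂μ) := by
        refine le_trans (le_of_eq ?_) (Real.add_one_le_exp _)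
        ring

theorem measureReal_sum_le_sub_le_exp {Y : ι → Ω → ℝ} {s : Finset ι} (h_indep : iIndepFun Y μ)
    (hY : ∀ i, MemLp (Y i) 2 μ) (h0 : ∀ i, 0 ≤ᵐ[μ] Y i) {q r : ℝ}
    (hq : ∑ i ∈ s, ∫ ω, Y i ω ^ 2 ∂μ ≤ q) (hr : 0 ≤ r) :
    μ.real {ω | ∑ i ∈ s, Y i ω ≤ ∑ i ∈ s, μ[Y i] - r} ≤ Real.exp (-(r ^ 2 / (2 * q))) := by
  have := h_indep.isProbabilityMeasure
  set m := ∑ i ∈ s, μ[Y i]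
  have hq0 : 0 ≤ q :=
    (sum_nonneg fun i _ => integral_nonneg fun ω => sq_nonneg (Y i ω)).trans hq
  have hm : ∀ i, AEMeasurable (Y i) μ := fun i => (hY i).aestronglyMeasurable.aemeasurable
  have ht : 0 ≤ r / q := div_nonneg hr hq0
  have hsum0 : 0 ≤ᵐ[μ] ∑ i ∈ s, Y i := by
    filter_upwards [(Finset.eventually_all s).2 fun i _ => h0 i] with ω hω
    simpa using sum_nonneg hω
  calc μ.real {ω | ∑ i ∈ s, Y i ω ≤ m - r}
      = μ.real {ω | (∑ i ∈ s, Y i) ω ≤ m - r} := by simp only [Finset.sum_apply]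
    _ ≤ Real.exp (- -(r / q) * (m - r)) * mgf (∑ i ∈ s, Y i) μ (-(r / q)) :=
        measure_le_le_exp_mul_mgf _ (neg_nonpos.2 ht)
          (integrable_exp_neg_mul_of_nonneg (s.aemeasurable_sum fun i _ => hm i) hsum0 ht)
    _ ≤ Real.exp (- -(r / q) * (m - r)) *
          ∏ i ∈ s, Real.exp (-(r / q) * μ[Y i] + (r / q) ^ 2 / 2 * ∫ ω, Y i ω ^ 2 ∂μ) := by
        rw [h_indep.mgf_sum₀ hm]
        gcongr with i
        · exact fun i _ => mgf_nonneg
        · exact mgf_neg_le_of_nonneg (hY i) (h0 i) ht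
    _ ≤ Real.exp (- -(r / q) * (m - r)) * Real.exp (-(r / q) * m + (r / q) ^ 2 / 2 * q) := by
        rw [← Real.exp_sum, sum_add_distrib, ← mul_sum, ← mul_sum]
        gcongr
    _ = Real.exp (-(r ^ 2 / (2 * q))) := by
        rw [← Real.exp_add]
        congr 1
        rcases eq_or_ne q 0 with h | h
        · simp [h]
        · field_simp
          ring

theorem measureReal_sum_le_one_sub_mul_le_exp {Y : ι → Ω → ℝ} {s : Finset ι}
    (h_indep : iIndepFun Y μ) (hm : ∀ i, AEMeasurable (Y i) μ)
    (h01 : ∀ i, ∀ᵐ ω ∂μ, Y i ω ∈ Set.Icc 0 1) {p ε : ℝ} (hp : ∀ i, p ≤ μ[Y i]) (hε : 0 ≤ ε)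
    (hε1 : ε ≤ 1) :
    μ.real {ω | ∑ i ∈ s, Y i ω ≤ (1 - ε) * (#s * p)} ≤ Real.exp (-(ε ^ 2 / 2 * (#s * p))) := by
  have := h_indep.isProbabilityMeasure
  have hLp : ∀ i, MemLp (Y i) 2 μ := fun i =>
    memLp_of_bounded (h01 i) (hm i).aestronglyMeasurable 2
  have hmean : #s * p ≤ ∑ i ∈ s, μ[Y i] := by
    simpa using card_nsmul_le_sum s _ p fun i _ => hp i
  have hsq : ∑ i ∈ s, ∫ ω, Y i ω ^ 2 ∂μ ≤ ∑ i ∈ s, μ[Y i] := by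
    refine sum_le_sum fun i _ => integral_mono_ae (hLp i).integrable_sq
      ((hLp i).integrable (by norm_num)) ?_
    filter_upwards [h01 i] with ω hω
    exact pow_le_of_le_one hω.1 hω.2 two_ne_zero
  have hm0 : 0 ≤ ∑ i ∈ s, μ[Y i] :=
    (sum_nonneg fun i _ => integral_nonneg fun ω => sq_nonneg (Y i ω)).trans hsq
  set m := ∑ i ∈ s, μ[Y i]
  calc μ.real {ω | ∑ i ∈ s, Y i ω ≤ (1 - ε) * (#s * p)}
      ≤ μ.real {ω | ∑ i ∈ s, Y i ω ≤ m - ε * m} := by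
        refine measureReal_mono fun ω (hω : ∑ i ∈ s, Y i ω ≤ (1 - ε) * (#s * p)) => hω.trans ?_
        nlinarith
    _ ≤ Real.exp (-((ε * m) ^ 2 / (2 * m))) :=
        measureReal_sum_le_sub_le_exp h_indep hLp
          (fun i => (h01 i).mono fun _ h => h.1) hsq (mul_nonneg hε hm0)
    _ ≤ Real.exp (-(ε ^ 2 / 2 * (#s * p))) := by
        have hexp : (ε * m) ^ 2 / (2 * m) = ε ^ 2 / 2 * m := by
          rcases eq_or_ne m 0 with h | h
          · simp [h]
          · field_simp
        rw [hexp]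
        gcongr

theorem measureReal_pi_card_le_exp {E : Type*} [MeasurableSpace E] [Fintype ι] {ν : Measure E}
    [IsProbabilityMeasure ν] {s : Set E} [DecidablePred (· ∈ s)] (hs : MeasurableSet s) {p ε : ℝ}
    (hp : p ≤ ν.real s) (hε : 0 ≤ ε) (hε1 : ε ≤ 1) :
    (Measure.pi fun _ : ι => ν).real
        {x | (#{j | x j ∈ s} : ℝ) ≤ (1 - ε) * (Fintype.card ι * p)} ≤
      Real.exp (-(ε ^ 2 / 2 * (Fintype.card ι * p))) := by
  let Y (j : ι) (x : ι → E) : ℝ := s.indicator 1 (x j)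
  have hind : Measurable (s.indicator (1 : E → ℝ)) := measurable_one.indicator hs
  have hmean (j : ι) : p ≤ ∫ x, Y j x ∂Measure.pi fun _ => ν := by
    rw [integral_comp_eval (μ := fun _ : ι => ν) hind.aestronglyMeasurable]
    simpa [integral_indicator_one hs] using hp
  have hcard (x : ι → E) : (#{j | x j ∈ s} : ℝ) = ∑ j, Y j x := by
    simp [Y, Set.indicator_apply]
  have hY01 (j : ι) (x : ι → E) : Y j x ∈ Set.Icc 0 1 := by
    by_cases h : x j ∈ s <;> simp [Y, h]
  have hindep : iIndepFun Y (Measure.pi fun _ => ν) := iIndepFun_pi fun _ => hind.aemeasurable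
  simpa only [hcard, card_univ] using measureReal_sum_le_one_sub_mul_le_exp (s := univ) hindep
    (fun j => (hind.comp (measurable_pi_apply j)).aemeasurable)
    (fun j => ae_of_all _ (hY01 j)) hmean hε hε1

theorem lintegral_exp_mul_sq_gaussianReal {a : ℝ} (ha : 2 * a < 1) :
    ∫⁻ x, ENNReal.ofReal (Real.exp (a * x ^ 2)) ∂gaussianReal 0 1 =
      ENNReal.ofReal (√(1 - 2 * a))⁻¹ := by
  have hb : 0 < 1 / 2 - a := by linarith
  have hpdf : ∀ x, gaussianPDF 0 1 x * ENNReal.ofReal (Real.exp (a * x ^ 2)) =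
      ENNReal.ofReal ((√(2 * Real.pi))⁻¹ * Real.exp (-(1 / 2 - a) * x ^ 2)) := fun x => by
    rw [gaussianPDF, ← ENNReal.ofReal_mul (gaussianPDFReal_nonneg _ _ _), gaussianPDFReal,
      mul_assoc, ← Real.exp_add]
    norm_num
    ring_nf
  rw [gaussianReal_of_var_ne_zero 0 one_ne_zero, lintegral_withDensity_eq_lintegral_mul _
    (measurable_gaussianPDF 0 1) (by fun_prop)]
  simp only [Pi.mul_apply, hpdf]
  rw [← ofReal_integral_eq_lintegral_ofReal ((integrable_exp_neg_mul_sq hb).const_mul _)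
    (ae_of_all _ fun x => by positivity), integral_const_mul, integral_gaussian,
    ← Real.sqrt_inv, ← Real.sqrt_inv, ← Real.sqrt_mul (by positivity)]
  congr 2
  field_simp

theorem lintegral_exp_mul_gaussianReal (y : ℝ) :
    ∫⁻ g, ENNReal.ofReal (Real.exp (g * y)) ∂gaussianReal 0 1 =
      ENNReal.ofReal (Real.exp (y ^ 2 / 2)) := by
  have h := congrFun (mgf_id_gaussianReal (μ := 0) (v := 1)) y
  rw [← ofReal_integral_eq_lintegral_ofReal _ (ae_of_all _ fun x => (Real.exp_pos _).le)]
  · simp only [mgf, id_eq] at h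
    simp only [mul_comm _ y, h]
    norm_num
  · simpa only [mul_comm _ y] using integrable_exp_mul_gaussianReal y

theorem lintegral_exp_mul_sq_le_of_hasSubgaussianMGF [SFinite μ] {Y : Ω → ℝ} {w : ℝ≥0}
    (hY : HasSubgaussianMGF Y w μ) {l : ℝ} (hl : 0 ≤ l) (hlw : 2 * (l * w) < 1) :
    ∫⁻ ω, ENNReal.ofReal (Real.exp (l * Y ω ^ 2)) ∂μ ≤
      ENNReal.ofReal (√(1 - 2 * (l * w)))⁻¹ := by
  -- `exp (l Y²)` is the expectation of `exp (g √(2l) Y)` over an independent standard Gaussian `g`.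
  calc ∫⁻ ω, ENNReal.ofReal (Real.exp (l * Y ω ^ 2)) ∂μ
      = ∫⁻ ω, ∫⁻ g, ENNReal.ofReal (Real.exp (g * (√(2 * l) * Y ω))) ∂gaussianReal 0 1 ∂μ := by
        simp only [lintegral_exp_mul_gaussianReal, mul_pow, Real.sq_sqrt (mul_nonneg two_pos.le hl)]
        refine lintegral_congr fun ω => ?_
        ring_nf
    _ = ∫⁻ g, ∫⁻ ω, ENNReal.ofReal (Real.exp (g * √(2 * l) * Y ω)) ∂μ ∂gaussianReal 0 1 := by
        simp only [← mul_assoc]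
        refine lintegral_lintegral_swap (AEMeasurable.ennreal_ofReal (.exp ?_))
        exact (measurable_snd.mul_const _).aemeasurable.mul hY.aemeasurable.comp_fst
    _ ≤ ∫⁻ g, ENNReal.ofReal (Real.exp ((l * w) * g ^ 2)) ∂gaussianReal 0 1 := by
        refine lintegral_mono fun g => ?_
        rw [← ofReal_integral_eq_lintegral_ofReal (hY.integrable_exp_mul _)
          (ae_of_all _ fun x => (Real.exp_pos _).le)]
        refine ENNReal.ofReal_le_ofReal ((hY.mgf_le _).trans_eq ?_)
        rw [mul_pow, Real.sq_sqrt (mul_nonneg two_pos.le hl)]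
        ring_nf
    _ = ENNReal.ofReal (√(1 - 2 * (l * w)))⁻¹ := lintegral_exp_mul_sq_gaussianReal hlw

theorem integrable_exp_mul_sq_of_hasSubgaussianMGF [SFinite μ] {Y : Ω → ℝ} {w : ℝ≥0}
    (hY : HasSubgaussianMGF Y w μ) {l : ℝ} (hl : 0 ≤ l) (hlw : 2 * (l * w) < 1) :
    Integrable (fun ω => Real.exp (l * Y ω ^ 2)) μ := by
  have hm : AEMeasurable (fun ω => Real.exp (l * Y ω ^ 2)) μ :=
    ((hY.aemeasurable.pow_const 2).const_mul l).exp
  refine ⟨hm.aestronglyMeasurable, ?_⟩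
  rw [hasFiniteIntegral_iff_ofReal (ae_of_all _ fun ω => (Real.exp_pos _).le)]
  exact (lintegral_exp_mul_sq_le_of_hasSubgaussianMGF hY hl hlw).trans_lt ENNReal.ofReal_lt_top

theorem mgf_sq_le_of_hasSubgaussianMGF [SFinite μ] {Y : Ω → ℝ} {w : ℝ≥0}
    (hY : HasSubgaussianMGF Y w μ) {l : ℝ} (hl : 0 ≤ l) (hlw : 2 * (l * w) < 1) :
    mgf (fun ω => Y ω ^ 2) μ l ≤ (√(1 - 2 * (l * w)))⁻¹ := by
  simp only [mgf]
  rw [← ENNReal.ofReal_le_ofReal_iff (by positivity), ofReal_integral_eq_lintegral_ofReal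
    (integrable_exp_mul_sq_of_hasSubgaussianMGF hY hl hlw)
    (ae_of_all _ fun x => (Real.exp_pos _).le)]
  exact lintegral_exp_mul_sq_le_of_hasSubgaussianMGF hY hl hlw

theorem inv_sqrt_one_sub_two_mul_le_exp {x : ℝ} (h0 : 0 ≤ x) (h : x ≤ 1 / 4) :
    (√(1 - 2 * x))⁻¹ ≤ Real.exp (x + 2 * x ^ 2) := by
  have hpos : 0 < 1 - 2 * x := by linarith
  have hle : (1 - 2 * x)⁻¹ ≤ Real.exp (2 * (x + 2 * x ^ 2)) := by
    refine le_trans ?_ (Real.quadratic_le_exp_of_nonneg (by positivity))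
    rw [inv_le_iff_one_le_mul₀ hpos]
    nlinarith [mul_nonneg (sq_nonneg x) (by nlinarith : 0 ≤ 2 - 4 * x - 8 * x ^ 2 - 16 * x ^ 3)]
  rw [← Real.sqrt_inv]
  refine (Real.sqrt_le_sqrt hle).trans_eq ?_
  rw [Real.sqrt_eq_iff_mul_self_eq (Real.exp_pos _).le (Real.exp_pos _).le, ← Real.exp_add]
  ring_nf

theorem integrable_pow_four_of_hasSubgaussianMGF [IsFiniteMeasure μ] {Y : Ω → ℝ} {w : ℝ≥0}
    (hY : HasSubgaussianMGF Y w μ) : Integrable (fun ω => Y ω ^ 4) μ := by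
  simpa [Even.pow_abs (by decide : Even 4)] using (hY.memLp 4).integrable_norm_pow (by norm_num)

theorem integral_pow_four_le_of_hasSubgaussianMGF [IsProbabilityMeasure μ] {Y : Ω → ℝ} {w : ℝ≥0}
    (hY : HasSubgaussianMGF Y w μ) : ∫ ω, Y ω ^ 4 ∂μ ≤ 16 * w ^ 2 := by
  rcases eq_or_ne w 0 with rfl | hw
  · rw [integral_eq_zero_of_ae]
    · simp
    · filter_upwards [hY.ae_eq_zero_of_hasSubgaussianMGF_zero] with ω hω
      simp [hω]
  have : (0 : ℝ) < w := NNReal.coe_pos.2 (pos_iff_ne_zero.2 hw)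
  have hlw : 2 * (1 / (4 * w) * w : ℝ) = 1 / 2 := by field_simp; norm_num
  have hlw1 : 2 * (1 / (4 * w) * w : ℝ) < 1 := by rw [hlw]; norm_num
  have hsqrt : (√(1 - 1 / 2 : ℝ))⁻¹ ≤ 3 / 2 := by
    rw [← Real.sqrt_inv, Real.sqrt_le_left (by norm_num)]
    norm_num
  have hint := integrable_pow_four_of_hasSubgaussianMGF hY
  have hexp : ∫ ω, 1 + Y ω ^ 4 / (32 * w ^ 2) ∂μ ≤ 3 / 2 :=
    calc ∫ ω, 1 + Y ω ^ 4 / (32 * w ^ 2) ∂μ ≤ mgf (fun ω => Y ω ^ 2) μ (1 / (4 * w)) := by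
          refine integral_mono ((integrable_const 1).add (hint.div_const _))
            (integrable_exp_mul_sq_of_hasSubgaussianMGF hY (by positivity) hlw1) fun ω => ?_
          have h := Real.quadratic_le_exp_of_nonneg
            (x := 1 / (4 * w) * Y ω ^ 2) (by positivity)
          have h0 : 0 ≤ 1 / (4 * w) * Y ω ^ 2 := by positivity
          have h2 : (1 / (4 * w) * Y ω ^ 2) ^ 2 / 2 = Y ω ^ 4 / (32 * w ^ 2) := by
            field_simp; ring
          dsimp only
          linarith
      _ ≤ 3 / 2 := by
          refine (mgf_sq_le_of_hasSubgaussianMGF hY (by positivity) hlw1).trans ?_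
          rwa [hlw]
  rw [integral_add (integrable_const 1) (hint.div_const _), integral_const, probReal_univ,
    one_smul, integral_div] at hexp
  have hdiv : (∫ ω, Y ω ^ 4 ∂μ) / (32 * w ^ 2) ≤ 1 / 2 := by linarith
  rw [div_le_iff₀ (by positivity)] at hdiv
  linarith

theorem measureReal_one_add_mul_le_sum_sq_le_exp [Fintype κ] {Y : κ → Ω → ℝ} {w : ℝ≥0}
    (h_indep : iIndepFun Y μ) (hm : ∀ k, Measurable (Y k))
    (hY : ∀ k, HasSubgaussianMGF (Y k) w μ) (hw : w ≠ 0) {ε : ℝ} (hε : 0 ≤ ε) (hε1 : ε ≤ 1) :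
    μ.real {ω | (1 + ε) * (Fintype.card κ * w) ≤ ∑ k, Y k ω ^ 2} ≤
      Real.exp (-(ε ^ 2 / 8 * Fintype.card κ)) := by
  have := h_indep.isProbabilityMeasure
  have : (0 : ℝ) < w := NNReal.coe_pos.2 (pos_iff_ne_zero.2 hw)
  set c : ℝ := (Fintype.card κ : ℝ)
  have hl : 0 ≤ ε / (4 * w) := by positivity
  have hlw : ε / (4 * w) * w = ε / 4 := by field_simp
  have hlw1 : 2 * (ε / (4 * w) * w) < 1 := by rw [hlw]; linarith
  have hsq_meas : ∀ k, Measurable fun ω => Y k ω ^ 2 := fun k => (hm k).pow_const 2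
  have hsq_indep : iIndepFun (fun k ω => Y k ω ^ 2) μ :=
    h_indep.comp (fun _ x => x ^ 2) fun _ => measurable_id.pow_const 2
  have hmgf : ∀ k, mgf (fun ω => Y k ω ^ 2) μ (ε / (4 * w)) ≤ Real.exp (ε / 4 + ε ^ 2 / 8) :=
      fun k => by
    refine (mgf_sq_le_of_hasSubgaussianMGF (hY k) hl hlw1).trans ?_
    rw [hlw]
    refine (inv_sqrt_one_sub_two_mul_le_exp (by positivity) (by linarith)).trans_eq ?_
    ring_nf
  calc μ.real {ω | (1 + ε) * (c * w) ≤ ∑ k, Y k ω ^ 2}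
      = μ.real {ω | (1 + ε) * (c * w) ≤ (∑ k, fun ω => Y k ω ^ 2) ω} := by
        simp only [Finset.sum_apply]
    _ ≤ Real.exp (-(ε / (4 * w)) * ((1 + ε) * (c * w))) *
          mgf (∑ k, fun ω => Y k ω ^ 2) μ (ε / (4 * w)) :=
        measure_ge_le_exp_mul_mgf _ hl <| hsq_indep.integrable_exp_mul_sum hsq_meas fun k _ =>
          integrable_exp_mul_sq_of_hasSubgaussianMGF (hY k) hl hlw1
    _ ≤ Real.exp (-(ε / (4 * w)) * ((1 + ε) * (c * w))) *
          ∏ _k : κ, Real.exp (ε / 4 + ε ^ 2 / 8) := by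
        rw [hsq_indep.mgf_sum hsq_meas]
        gcongr with k
        · exact fun k _ => mgf_nonneg
        · exact hmgf k
    _ = Real.exp (-(ε ^ 2 / 8 * c)) := by
        rw [prod_const, ← Real.exp_nat_mul, ← Real.exp_add, Finset.card_univ]
        congr 1
        change _ + c * _ = _
        field_simp
        ring

theorem measureReal_sum_sq_le_one_sub_mul_le_exp [Fintype κ] {Y : κ → Ω → ℝ} {w : ℝ≥0}
    (h_indep : iIndepFun Y μ) (hY : ∀ k, HasSubgaussianMGF (Y k) w μ)
    (hvar : ∀ k, ∫ ω, Y k ω ^ 2 ∂μ = (w : ℝ)) (hw : w ≠ 0) {ε : ℝ} (hε : 0 ≤ ε) :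
    μ.real {ω | ∑ k, Y k ω ^ 2 ≤ (1 - ε) * (Fintype.card κ * w)} ≤
      Real.exp (-(ε ^ 2 / 32 * Fintype.card κ)) := by
  have := h_indep.isProbabilityMeasure
  have : (0 : ℝ) < w := NNReal.coe_pos.2 (pos_iff_ne_zero.2 hw)
  set c : ℝ := (Fintype.card κ : ℝ)
  have hsq_indep : iIndepFun (fun k ω => Y k ω ^ 2) μ :=
    h_indep.comp (fun _ x => x ^ 2) fun _ => measurable_id.pow_const 2
  have hLp : ∀ k, MemLp (fun ω => Y k ω ^ 2) 2 μ := fun k => by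
    refine (memLp_two_iff_integrable_sq
      ((hY k).aemeasurable.pow_const 2).aestronglyMeasurable).2 ?_
    simpa only [← pow_mul] using integrable_pow_four_of_hasSubgaussianMGF (hY k)
  have hmean : ∑ k, ∫ ω, Y k ω ^ 2 ∂μ = c * w := by
    simp only [hvar, sum_const, card_univ, nsmul_eq_mul, c]
  have hfour : ∑ k, ∫ ω, (Y k ω ^ 2) ^ 2 ∂μ ≤ c * (16 * w ^ 2) := by
    refine (sum_le_card_nsmul _ _ (16 * (w : ℝ) ^ 2) fun k _ => ?_).trans_eq ?_
    · simpa only [← pow_mul] using integral_pow_four_le_of_hasSubgaussianMGF (hY k)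
    · rw [nsmul_eq_mul, card_univ]
  calc μ.real {ω | ∑ k, Y k ω ^ 2 ≤ (1 - ε) * (c * w)}
      = μ.real {ω | ∑ k, Y k ω ^ 2 ≤ ∑ k, ∫ ω, Y k ω ^ 2 ∂μ - ε * (c * w)} := by
        rw [hmean]
        ring_nf
    _ ≤ Real.exp (-((ε * (c * w)) ^ 2 / (2 * (c * (16 * w ^ 2))))) :=
        measureReal_sum_le_sub_le_exp hsq_indep hLp
          (fun k => ae_of_all _ fun ω => sq_nonneg (Y k ω)) hfour (by positivity)
    _ = Real.exp (-(ε ^ 2 / 32 * c)) := by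
        congr 2
        rcases eq_or_ne c 0 with h | h
        · simp [h]
        · field_simp
          ring

theorem measureReal_lt_abs_sum_sq_sub_le_two_mul_exp [Fintype κ] {Y : κ → Ω → ℝ} {w : ℝ≥0}
    (h_indep : iIndepFun Y μ) (hm : ∀ k, Measurable (Y k))
    (hY : ∀ k, HasSubgaussianMGF (Y k) w μ) (hvar : ∀ k, ∫ ω, Y k ω ^ 2 ∂μ = (w : ℝ)) {ε : ℝ}
    (hε : 0 ≤ ε) (hε1 : ε ≤ 1) :
    μ.real {ω | ε * (Fintype.card κ * w) < |∑ k, Y k ω ^ 2 - Fintype.card κ * w|} ≤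
      2 * Real.exp (-(ε ^ 2 / 32 * Fintype.card κ)) := by
  have := h_indep.isProbabilityMeasure
  rcases eq_or_ne w 0 with rfl | hw
  · rw [measureReal_def, measure_eq_zero_iff_ae_notMem.2 ?_, ENNReal.toReal_zero]
    · positivity
    · filter_upwards [eventually_countable_forall.2 fun k =>
        (hY k).ae_eq_zero_of_hasSubgaussianMGF_zero] with ω hω
      simp [hω]
  set m : ℝ := Fintype.card κ * w
  calc μ.real {ω | ε * m < |∑ k, Y k ω ^ 2 - m|}
      ≤ μ.real ({ω | (1 + ε) * m ≤ ∑ k, Y k ω ^ 2} ∪ {ω | ∑ k, Y k ω ^ 2 ≤ (1 - ε) * m}) := by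
        refine measureReal_mono fun ω (hω : ε * m < _) => ?_
        rcases lt_abs.1 hω with h | h
        · exact Or.inl (show (1 + ε) * m ≤ _ by linarith)
        · exact Or.inr (show _ ≤ (1 - ε) * m by linarith)
    _ ≤ Real.exp (-(ε ^ 2 / 8 * Fintype.card κ)) + Real.exp (-(ε ^ 2 / 32 * Fintype.card κ)) :=
        (measureReal_union_le _ _).trans <| add_le_add
          (measureReal_one_add_mul_le_sum_sq_le_exp h_indep hm hY hw hε hε1)
          (measureReal_sum_sq_le_one_sub_mul_le_exp h_indep hY hvar hw hε)
    _ ≤ 2 * Real.exp (-(ε ^ 2 / 32 * Fintype.card κ)) := by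
        rw [two_mul]
        gcongr
        norm_num

theorem iIndepFun_curry {𝓧 : Type*} [MeasurableSpace 𝓧] {X : ι → κ → Ω → 𝓧}
    (hm : ∀ i j, Measurable (X i j)) (h : iIndepFun (fun p : ι × κ => X p.1 p.2) μ) :
    iIndepFun (fun i ω j => X i j ω) μ := by
  have := h.isProbabilityMeasure
  have hprob : ∀ i j, IsProbabilityMeasure (μ.map (X i j)) := fun i j =>
    Measure.isProbabilityMeasure_map (hm i j).aemeasurable
  have hrow : ∀ i, μ.map (fun ω j => X i j ω) = Measure.infinitePi fun j => μ.map (X i j) :=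
    fun i => (h.precomp (Prod.mk_right_injective i)).map_fun_eq_infinitePi_map (hm i)
  have hcurry : (fun ω i j => X i j ω) = MeasurableEquiv.curry ι κ 𝓧 ∘ fun ω p => X p.1 p.2 ω :=
    rfl
  have hjoint : μ.map (fun ω p => X p.1 p.2 ω) =
      Measure.infinitePi fun p : ι × κ => μ.map (X p.1 p.2) :=
    h.map_fun_eq_infinitePi_map fun p => hm p.1 p.2
  rw [iIndepFun_iff_map_fun_eq_infinitePi_map fun i => by fun_prop]
  simp only [hrow]
  rw [hcurry, ← Measure.map_map (by fun_prop) (by fun_prop), hjoint,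
    Measure.infinitePi_map_curry fun i j => μ.map (X i j)]

section JohnsonLindenstrauss

variable {G : Ω → Matrix ι κ ℝ} {v : ℝ≥0}

theorem iIndepFun_mul_entry (h_indep : iIndepFun (fun (p : ι × κ) ω => G ω p.1 p.2) μ)
    (x : ι → ℝ) (k : κ) : iIndepFun (fun i ω => x i * G ω i k) μ :=
  (h_indep.precomp (Prod.mk_left_injective k)).comp (fun i t => x i * t) fun i => by fun_prop

variable [Fintype ι]

theorem iIndepFun_mulVec_transpose (hm : ∀ i k, Measurable fun ω => G ω i k)
    (h_indep : iIndepFun (fun (p : ι × κ) ω => G ω p.1 p.2) μ) (x : ι → ℝ) :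
    iIndepFun (fun k ω => (G ω).transpose.mulVec x k) μ :=
  (iIndepFun_curry (X := fun k i ω => G ω i k) (fun k i => hm i k)
    (h_indep.precomp Prod.swap_injective)).comp (fun _ u => ∑ i, u i * x i) fun _ => by fun_prop

theorem mulVec_transpose_apply (A : Matrix ι κ ℝ) (x : ι → ℝ) (k : κ) :
    A.transpose.mulVec x k = ∑ i, x i * A i k := by
  simp only [Matrix.mulVec, dotProduct, Matrix.transpose_apply, mul_comm]

theorem hasSubgaussianMGF_mulVec_transpose
    (h_indep : iIndepFun (fun (p : ι × κ) ω => G ω p.1 p.2) μ)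
    (hG : ∀ i k, HasSubgaussianMGF (fun ω => G ω i k) v μ) (x : EuclideanSpace ℝ ι) (k : κ) :
    HasSubgaussianMGF (fun ω => (G ω).transpose.mulVec x k) (‖x‖₊ ^ 2 * v) μ := by
  have h := HasSubgaussianMGF.sum_of_iIndepFun (iIndepFun_mul_entry h_indep x k) (s := univ)
    fun i _ => (hG i k).const_mul (x i)
  convert h using 1
  · simp only [mulVec_transpose_apply]
  · ext
    push_cast
    rw [EuclideanSpace.real_norm_sq_eq, sum_mul]
    rfl

theorem integral_mulVec_transpose_sq
    (h_indep : iIndepFun (fun (p : ι × κ) ω => G ω p.1 p.2) μ)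
    (hG : ∀ i k, MemLp (fun ω => G ω i k) 2 μ) (hmean : ∀ i k, ∫ ω, G ω i k ∂μ = 0)
    (hvar : ∀ i k, ∫ ω, G ω i k ^ 2 ∂μ = v) (x : EuclideanSpace ℝ ι) (k : κ) :
    ∫ ω, (G ω).transpose.mulVec x k ^ 2 ∂μ = ‖x‖ ^ 2 * v := by
  have := h_indep.isProbabilityMeasure
  have hLp : ∀ i, MemLp (fun ω => x i * G ω i k) 2 μ := fun i => (hG i k).const_mul (x i)
  have hmean_term : ∀ i, ∫ ω, x i * G ω i k ∂μ = 0 := fun i => by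
    rw [integral_const_mul, hmean, mul_zero]
  have hvar_term : ∀ i, variance (fun ω => x i * G ω i k) μ = x i ^ 2 * v := fun i => by
    rw [variance_const_mul, variance_of_integral_eq_zero (hG i k).aemeasurable (hmean i k), hvar]
  have hmean_sum : ∫ ω, ∑ i, x i * G ω i k ∂μ = 0 := by
    rw [integral_finsetSum _ fun i _ => (hLp i).integrable (by norm_num)]
    simp only [hmean_term, sum_const_zero]
  simp only [mulVec_transpose_apply]
  calc ∫ ω, (∑ i, x i * G ω i k) ^ 2 ∂μ = variance (∑ i, fun ω => x i * G ω i k) μ := by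
        rw [sum_fn]
        exact (variance_of_integral_eq_zero
          (Finset.aemeasurable_fun_sum _ fun i _ => (hLp i).aemeasurable) hmean_sum).symm
    _ = ∑ i, x i ^ 2 * v := by
        rw [IndepFun.variance_sum (fun i _ => hLp i) fun i _ j _ hij =>
          (iIndepFun_mul_entry h_indep x k).indepFun hij]
        simp only [hvar_term]
    _ = ‖x‖ ^ 2 * v := by rw [EuclideanSpace.real_norm_sq_eq, sum_mul]

theorem measureReal_lt_abs_sum_mulVec_transpose_sq_sub_le [Fintype κ]
    (hm : ∀ i k, Measurable fun ω => G ω i k)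
    (h_indep : iIndepFun (fun (p : ι × κ) ω => G ω p.1 p.2) μ)
    (hG : ∀ i k, HasSubgaussianMGF (fun ω => G ω i k) v μ)
    (hmean : ∀ i k, ∫ ω, G ω i k ∂μ = 0) (hvar : ∀ i k, ∫ ω, G ω i k ^ 2 ∂μ = v)
    (x : EuclideanSpace ℝ ι) {ε : ℝ} (hε : 0 ≤ ε) (hε1 : ε ≤ 1) :
    μ.real {ω | ε * (Fintype.card κ * (‖x‖ ^ 2 * v)) <
        |∑ k, (G ω).transpose.mulVec x k ^ 2 - Fintype.card κ * (‖x‖ ^ 2 * v)|} ≤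
      2 * Real.exp (-(ε ^ 2 / 32 * Fintype.card κ)) := by
  have := h_indep.isProbabilityMeasure
  have hsecond : ∀ k, ∫ ω, (G ω).transpose.mulVec x k ^ 2 ∂μ = ((‖x‖₊ ^ 2 * v : ℝ≥0) : ℝ) :=
    fun k => integral_mulVec_transpose_sq h_indep (fun i k => (hG i k).memLp 2) hmean hvar x k
  refine measureReal_lt_abs_sum_sq_sub_le_two_mul_exp (w := ‖x‖₊ ^ 2 * v)
    (iIndepFun_mulVec_transpose hm h_indep x) (fun k => ?_)
    (hasSubgaussianMGF_mulVec_transpose h_indep hG x) hsecond hε hε1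
  simp only [mulVec_transpose_apply]
  fun_prop

end JohnsonLindenstrauss

end Concentration

/-! ### Semantics of programs -/

namespace Prog

variable {n d : ℕ} {A B : Type}

section Semantics

variable [NeZero n] {X : Fin n → EuclideanSpace ℝ (Fin d)}

theorem map_fst_chargeStep (p : PMF (A × ℕ)) : (chargeStep p).map Prod.fst = p.map Prod.fst := by
  rw [chargeStep, PMF.map_comp]
  rfl

theorem chargeStep_bind (p : PMF (A × ℕ)) (f : A → PMF (B × ℕ)) :
    chargeStep (p.bind fun a => (f a.1).map fun b => (b.1, a.2 + b.2)) =
      (chargeStep p).bind fun a => (f a.1).map fun b => (b.1, a.2 + b.2) := by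
  simp only [chargeStep, PMF.map_bind, PMF.bind_map, PMF.map_comp, Function.comp_def,
    add_right_comm]

theorem exec_bind (p : Prog ℝ n d A) (f : A → Prog ℝ n d B) :
    (p >>= f).exec X =
      (p.exec X).bind fun a => ((f a.1).exec X).map fun b => (b.1, a.2 + b.2) := by
  change (p.bind f).exec X = _
  have hcharge (q : PMF (A × ℕ)) := chargeStep_bind q fun a => (f a).exec X
  induction p with
  | ret a =>
    simp only [Prog.bind, exec, PMF.pure_bind, zero_add, Prod.mk.eta]
    exact (PMF.map_id _).symm
  | _ => simp only [Prog.bind, exec, PMF.bind_bind, *]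

/-- The law of the result of `p` on the input points `X`. -/
noncomputable def law (X : Fin n → EuclideanSpace ℝ (Fin d)) (p : Prog ℝ n d A) : PMF A :=
  (p.exec X).map Prod.fst

theorem law_pure (a : A) : law X (pure a : Prog ℝ n d A) = PMF.pure a :=
  PMF.pure_map _ _

theorem law_bind (p : Prog ℝ n d A) (f : A → Prog ℝ n d B) :
    law X (p >>= f) = (law X p).bind fun a => law X (f a) := by
  simp only [law, exec_bind, PMF.map_bind, PMF.bind_map, PMF.map_comp, Function.comp_def]

theorem law_sample : law X (sample ret) = PMF.uniformOfFintype (Fin n) := by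
  simp only [law, exec, PMF.map_bind, map_fst_chargeStep, PMF.pure_map, PMF.bind_pure]

theorem law_coin : law X (coin ret) = PMF.uniformOfFintype Bool := by
  simp only [law, exec, PMF.map_bind, map_fst_chargeStep, PMF.pure_map, PMF.bind_pure]

/-- Every execution of `p` ends with a result that satisfies `Q`, after at most `T` steps. -/
def Ensures (X : Fin n → EuclideanSpace ℝ (Fin d)) (p : Prog ℝ n d A) (Q : A → Prop) (T : ℕ) :
    Prop :=
  ∀ o ∈ (p.exec X).support, Q o.1 ∧ o.2 ≤ T

namespace Ensures

theorem mono {p : Prog ℝ n d A} {P Q : A → Prop} {S T : ℕ} (hp : Ensures X p P S)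
    (hPQ : ∀ a, P a → Q a) (hST : S ≤ T) : Ensures X p Q T :=
  fun o ho => ⟨hPQ _ (hp o ho).1, (hp o ho).2.trans hST⟩

theorem pure {a : A} {Q : A → Prop} (h : Q a) : Ensures X (Pure.pure a : Prog ℝ n d A) Q 0 := by
  intro o ho
  obtain rfl : o = (a, 0) := (PMF.mem_support_pure_iff _ _).1 ho
  exact ⟨h, le_rfl⟩

theorem bind {p : Prog ℝ n d A} {f : A → Prog ℝ n d B} {P : A → Prop} {Q : B → Prop}
    {S T : ℕ} (hp : Ensures X p P S) (hf : ∀ a, P a → Ensures X (f a) Q T) :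
    Ensures X (p >>= f) Q (S + T) := by
  intro o ho
  simp only [exec_bind, PMF.mem_support_bind_iff, PMF.mem_support_map_iff] at ho
  obtain ⟨a, ha, b, hb, rfl⟩ := ho
  have hQ := hf _ (hp a ha).1 b hb
  exact ⟨hQ.1, add_le_add (hp a ha).2 hQ.2⟩

theorem bind_eq {p : Prog ℝ n d A} {f : A → Prog ℝ n d B} {a : A} {Q : B → Prop}
    {S T : ℕ} (hp : Ensures X p (· = a) S) (hf : Ensures X (f a) Q T) :
    Ensures X (p >>= f) Q (S + T) :=
  hp.bind fun _ hb => hb ▸ hf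

theorem ite {c : Prop} [Decidable c] {p q : Prog ℝ n d A} {Q : A → Prop} {S T : ℕ}
    (hp : c → Ensures X p Q S) (hq : ¬ c → Ensures X q Q T) :
    Ensures X (if c then p else q) Q (max S T) := by
  split_ifs with h
  · exact (hp h).mono (fun _ h => h) (le_max_left _ _)
  · exact (hq h).mono (fun _ h => h) (le_max_right _ _)

theorem of_mem_support_law {p : Prog ℝ n d A} {Q : A → Prop} {T : ℕ} (hp : Ensures X p Q T)
    {a : A} (ha : a ∈ (law X p).support) : Q a := by
  obtain ⟨o, ho, rfl⟩ := (PMF.mem_support_map_iff _ _ _).1 ha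
  exact (hp o ho).1

theorem toOuterMeasure_law_eq_zero {p : Prog ℝ n d A} {Q : A → Prop} {T : ℕ}
    (hp : Ensures X p Q T) {s : Set A} (hs : ∀ a, Q a → a ∉ s) :
    (law X p).toOuterMeasure s = 0 :=
  (PMF.toOuterMeasure_apply_eq_zero_iff _ _).2 <|
    Set.disjoint_left.2 fun _ ha => hs _ (hp.of_mem_support_law ha)

theorem law_eq_pure {p : Prog ℝ n d A} {a : A} {T : ℕ} (hp : Ensures X p (· = a) T) :
    law X p = PMF.pure a := by
  have hsupp : (law X p).support = {a} :=
    (PMF.support_nonempty _).subset_singleton_iff.1 fun _ hb => hp.of_mem_support_law hb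
  ext b
  rcases eq_or_ne b a with rfl | hb
  · simpa using (PMF.apply_eq_one_iff _ _).2 hsupp
  · rw [PMF.pure_apply_of_ne _ _ hb, PMF.apply_eq_zero_iff, hsupp]
    exact hb

theorem law_bind_eq {p : Prog ℝ n d A} {a : A} {T : ℕ} (hp : Ensures X p (· = a) T)
    (f : A → Prog ℝ n d B) : law X (p >>= f) = law X (f a) := by
  rw [law_bind, hp.law_eq_pure, PMF.pure_bind]

end Ensures

theorem ensures_of_exec_eq {p : Prog ℝ n d A} {a : A}
    (h : p.exec X = chargeStep (PMF.pure (a, 0))) : Ensures X p (· = a) 1 := by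
  intro o ho
  rw [h, chargeStep, PMF.pure_map, PMF.mem_support_pure_iff] at ho
  simp [ho]

theorem ensures_tick : Ensures X (tick : Prog ℝ n d Unit) (fun _ => True) 1 :=
  (ensures_of_exec_eq (a := ()) rfl).mono (fun _ _ => trivial) le_rfl

theorem ensures_const (q : ℚ) : Ensures X (const q ret) (· = (q : ℝ)) 1 := ensures_of_exec_eq rfl

theorem ensures_ofNat (m : ℕ) : Ensures X (ofNat m ret) (· = (m : ℝ)) 1 := ensures_of_exec_eq rfl

theorem ensures_arith (o : BinOp) (x y : ℝ) : Ensures X (arith o x y) (· = o.eval x y) 1 :=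
  ensures_of_exec_eq rfl

theorem ensures_un (o : UnOp) (x : ℝ) : Ensures X (un o x ret) (· = o.eval x) 1 :=
  ensures_of_exec_eq rfl

open Classical in
theorem ensures_le (x y : ℝ) : Ensures X (le x y ret) (· = decide (x ≤ y)) 1 :=
  ensures_of_exec_eq rfl

theorem ensures_ceil (x : ℝ) : Ensures X (ceil x ret) (· = ⌈x⌉₊) 1 := ensures_of_exec_eq rfl

theorem ensures_read (i : Fin n) (j : Fin d) : Ensures X (read i j ret) (· = X i j) 1 :=
  ensures_of_exec_eq rfl

theorem ensures_sample : Ensures X (sample ret) (fun _ => True) 1 := by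
  intro o ho
  simp only [exec, chargeStep, PMF.pure_map, PMF.mem_support_bind_iff,
    PMF.mem_support_pure_iff] at ho
  obtain ⟨i, -, rfl⟩ := ho
  exact ⟨trivial, le_rfl⟩

theorem ensures_coin : Ensures X (coin ret) (fun _ => True) 1 := by
  intro o ho
  simp only [exec, chargeStep, PMF.pure_map, PMF.mem_support_bind_iff,
    PMF.mem_support_pure_iff] at ho
  obtain ⟨i, -, rfl⟩ := ho
  exact ⟨trivial, le_rfl⟩

theorem ensures_tabulate {T : ℕ} : ∀ {m : ℕ} {f : Fin m → Prog ℝ n d A} {P : Fin m → A → Prop},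
    (∀ i, Ensures X (f i) (P i) T) →
      Ensures X (tabulate m f) (fun v => ∀ i, P i (v i)) (m * (T + 1))
  | 0, _, _, _ => (Ensures.pure fun i => i.elim0).mono (fun _ h => h) (Nat.zero_le _)
  | m + 1, f, P, h => by
    refine (ensures_tick.bind fun _ _ => (h 0).bind fun a ha =>
      (ensures_tabulate fun i : Fin m => h i.succ).bind fun v hv =>
        Ensures.pure (Q := fun v : Fin (m + 1) → A => ∀ i, P i (v i)) ?_).mono (fun _ h => h) ?_
    · exact Fin.cases ha hv
    · exact le_of_eq (by ring)

theorem ensures_loop {T : ℕ} : ∀ {m : ℕ} {f : Fin m → A → Prog ℝ n d A} {I : ℕ → A → Prop}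
    {s : A},
    I 0 s → (∀ (i : Fin m) a, I i a → Ensures X (f i a) (I (i + 1)) T) →
      Ensures X (loop m f s) (I m) (m * (T + 1))
  | 0, _, _, _, h, _ => (Ensures.pure h).mono (fun _ h => h) (Nat.zero_le _)
  | m + 1, f, I, s, h0, h =>
    (ensures_tick.bind fun _ _ => (h 0 s h0).bind fun a ha =>
      ensures_loop (I := fun k => I (k + 1)) ha fun i a hi => h i.succ a hi).mono
        (fun _ h => h) (le_of_eq (by ring))

theorem ensures_loop_sum {T : ℕ} : ∀ {m : ℕ} {f : Fin m → ℝ → Prog ℝ n d ℝ} {g : Fin m → ℝ}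
    {s : ℝ},
    (∀ i a, Ensures X (f i a) (· = a + g i) T) →
      Ensures X (loop m f s) (· = s + ∑ i, g i) (m * (T + 1))
  | 0, _, _, _, _ => (Ensures.pure rfl).mono (fun a h => by simp [h]) (Nat.zero_le _)
  | m + 1, f, g, s, h => by
    refine (ensures_tick.bind fun _ _ => (h 0 s).bind (Q := (· = s + ∑ i, g i)) fun a ha =>
      (ensures_loop_sum (g := fun i => g i.succ) fun i a => h i.succ a).mono (fun b hb => ?_)
        le_rfl).mono (fun _ h => h) (le_of_eq (by ring))
    rw [hb, ha, Fin.sum_univ_succ, add_assoc]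

theorem ensures_loop_and {T : ℕ} : ∀ {m : ℕ} {f : Fin m → Bool → Prog ℝ n d Bool}
    {P : Fin m → Prop} {s : Bool},
    (∀ i b, Ensures X (f i b) (fun b' => b' = true ↔ b = true ∧ P i) T) →
      Ensures X (loop m f s) (fun b => b = true ↔ s = true ∧ ∀ i, P i) (m * (T + 1))
  | 0, _, _, _, _ => (Ensures.pure rfl).mono (fun a h => by simp [h]) (Nat.zero_le _)
  | m + 1, f, P, s, h => by
    refine (ensures_tick.bind fun _ _ => (h 0 s).bind
      (Q := fun b => b = true ↔ s = true ∧ ∀ i, P i) fun a ha =>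
      (ensures_loop_and (P := fun i => P i.succ) fun i a => h i.succ a).mono (fun b hb => ?_)
        le_rfl).mono (fun _ h => h) (le_of_eq (by ring))
    rw [hb, ha, Fin.forall_fin_succ, and_assoc]

end Semantics

end Prog

/-! ### What the algorithm computes, and in how many steps -/

/-- The state of a greedy selection among the indices `i < m`: `sel` indicates the selected
indices, `Dense` the candidates, and an index is skipped when it is `Close` to a selected one. -/
structure IsGreedySelection {N : ℕ} (Dense : Fin N → Prop) (Close : Fin N → Fin N → Prop) (m : ℕ)
    (sel : Fin N → Bool) : Prop where
  lt : ∀ i, sel i = true → i.1 < m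
  dense : ∀ i, sel i = true → Dense i
  not_close : ∀ i j, sel i = true → sel j = true → j ≠ i → ¬ Close i j
  exists_close : ∀ i : Fin N, i.1 < m → Dense i → sel i = false → ∃ j, sel j = true ∧ Close i j

namespace IsGreedySelection

variable {N : ℕ} {Dense : Fin N → Prop} {Close : Fin N → Fin N → Prop}

theorem zero : IsGreedySelection Dense Close 0 fun _ => false where
  lt i h := by simp at h
  dense i h := by simp at h
  not_close i j h := by simp at h
  exists_close i h := absurd h i.1.not_lt_zero

theorem exists_close_succ {i : Fin N} {sel : Fin N → Bool}
    (h : IsGreedySelection Dense Close i sel) (hi : Dense i → ∃ j, sel j = true ∧ Close i j)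
    {j : Fin N} (hj : j.1 < i + 1) (hd : Dense j) (hs : sel j = false) :
    ∃ k, sel k = true ∧ Close j k := by
  rcases Nat.lt_succ_iff_lt_or_eq.1 hj with hlt | heq
  · exact h.exists_close j hlt hd hs
  · obtain rfl : j = i := Fin.ext heq
    exact hi hd

theorem skip {i : Fin N} {sel : Fin N → Bool} (h : IsGreedySelection Dense Close i sel)
    (hi : Dense i → ∃ j, sel j = true ∧ Close i j) :
    IsGreedySelection Dense Close (i + 1) sel where
  lt j hj := (h.lt j hj).trans i.1.lt_succ_self
  dense := h.dense
  not_close := h.not_close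
  exists_close _ := h.exists_close_succ hi

theorem select {i : Fin N} {sel : Fin N → Bool} (h : IsGreedySelection Dense Close i sel)
    (hsymm : ∀ ⦃j k⦄, Close j k → Close k j) (hi : Dense i)
    (hsep : ∀ j, sel j = true → ¬ Close i j) :
    IsGreedySelection Dense Close (i + 1) (Function.update sel i true) := by
  have hsel : ∀ j, Function.update sel i true j = true ↔ j = i ∨ sel j = true := fun j => by
    by_cases hj : j = i <;> simp [hj]
  refine ⟨fun j hj => ?_, fun j hj => ?_, fun j k hj hk hkj => ?_, fun j hj hd hs => ?_⟩
  · rcases (hsel j).1 hj with rfl | hj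
    · exact j.1.lt_succ_self
    · exact (h.lt j hj).trans i.1.lt_succ_self
  · rcases (hsel j).1 hj with rfl | hj
    · exact hi
    · exact h.dense j hj
  · rcases (hsel j).1 hj with rfl | hj' <;> rcases (hsel k).1 hk with rfl | hk'
    · exact absurd rfl hkj
    · exact hsep k hk'
    · exact fun hjk => hsep j hj' (hsymm hjk)
    · exact h.not_close j k hj' hk' hkj
  · have hji : j ≠ i := fun hji => by simp [hji] at hs
    rw [Function.update_of_ne hji] at hs
    have hlt : j.1 < i := (Nat.lt_succ_iff.1 hj).lt_of_ne fun h => hji (Fin.ext h)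
    obtain ⟨k, hk, hjk⟩ := h.exists_close j hlt hd hs
    exact ⟨k, (hsel k).2 (Or.inr hk), hjk⟩

end IsGreedySelection

namespace Prog

variable {n d : ℕ} [NeZero n] {X : Fin n → EuclideanSpace ℝ (Fin d)}

theorem ensures_samplePoint : Ensures X samplePoint (fun _ => True) (1 + d * 2) :=
  ensures_sample.bind fun i _ =>
    (ensures_tabulate fun j => ensures_read i j).mono (fun _ _ => trivial) le_rfl

theorem ensures_signMatrix (c : ℕ) :
    Ensures X (signMatrix c) (fun _ => True) (6 + d * (c * 2 + 1)) := by
  have hentries (pos neg : ℝ) : Ensures X (tabulate d fun _ => tabulate c fun _ =>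
      coin ret >>= fun b => pure (if b then pos else neg)) (fun _ => True)
      (d * (c * (1 + 0 + 1) + 1)) :=
    (ensures_tabulate fun _ => ensures_tabulate fun _ => ensures_coin.bind fun _ _ =>
      Ensures.pure (Q := fun _ => True) trivial).mono (fun _ _ => trivial) le_rfl
  exact ((ensures_ofNat c).bind_eq <| (ensures_un _ _).bind_eq <| (ensures_const 1).bind_eq <|
    (ensures_const 0).bind_eq <| (ensures_arith _ _ _).bind_eq <| (ensures_arith _ _ _).bind_eq <|
    hentries _ _).mono (fun _ h => h) (le_of_eq (by ring))

theorem ensures_project {c : ℕ} (G : Matrix (Fin d) (Fin c) ℝ) (x : Fin d → ℝ) :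
    Ensures X (project G x) (· = G.transpose.mulVec x) (c * (d * 3 + 2)) := by
  refine (ensures_tabulate fun k => (ensures_const 0).bind_eq <|
    ensures_loop_sum (T := 2) (g := fun j => G j k * x j) fun j acc =>
      (ensures_arith _ _ _).bind_eq <| ensures_arith _ _ _).mono (fun v hv => ?_)
        (le_of_eq (by ring))
  funext k
  simp [hv k, Matrix.mulVec, dotProduct]

theorem ensures_sqDist {c : ℕ} (u v : Fin c → ℝ) :
    Ensures X (sqDist u v) (· = ∑ k, (u k - v k) ^ 2) (1 + c * 4) := by
  refine ((ensures_const 0).bind_eq <| ensures_loop_sum (T := 1 + (1 + 1))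
    (g := fun k => (u k - v k) ^ 2) fun k acc => (ensures_arith .sub (u k) (v k)).bind_eq <|
      (ensures_arith .mul _ _).bind_eq <|
        (ensures_arith _ _ _).mono (fun a ha => ?_) le_rfl).mono (fun a ha => ?_) le_rfl
  · rw [ha, sq]
    rfl
  · simpa using ha

open Classical in
theorem ensures_countClose {N c : ℕ} (y : Fin N → Fin c → ℝ) (r : ℝ) (i : Fin N) :
    Ensures X (countClose y r i) (· = (#{j | ∑ k, (y i k - y j k) ^ 2 ≤ r} : ℝ))
      (2 + N * (c * 4 + 4)) := by
  have hstep (j : Fin N) (cnt : ℝ) : Ensures X (do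
      let s ← sqDist (y i) (y j)
      let b ← le s r ret
      if b then arith .add cnt ((1 : ℚ) : ℝ) else pure cnt)
      (· = cnt + if ∑ k, (y i k - y j k) ^ 2 ≤ r then 1 else 0) (1 + c * 4 + (1 + max 1 0)) := by
    refine (ensures_sqDist _ _).bind_eq <| (ensures_le _ _).bind_eq <|
      Ensures.ite (fun h => (ensures_arith _ _ _).mono (fun a ha => ?_) le_rfl)
        fun h => Ensures.pure ?_
    · rw [ha, if_pos (of_decide_eq_true h), Rat.cast_one]
      rfl
    · rw [if_neg (by simpa using h), add_zero]
  have hcount : Ensures X (countClose y r i)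
      (· = ((0 : ℚ) : ℝ) + ∑ j, if ∑ k, (y i k - y j k) ^ 2 ≤ r then 1 else 0)
      (1 + (1 + N * (1 + c * 4 + (1 + max 1 0) + 1))) :=
    (ensures_const 0).bind_eq <| (ensures_const 1).bind_eq <| ensures_loop_sum hstep
  refine hcount.mono (fun a ha => by simpa using ha) (le_of_eq ?_)
  rw [max_eq_left zero_le_one]
  ring

theorem ensures_isSeparated {N c : ℕ} (y : Fin N → Fin c → ℝ) (r : ℝ) (sel : Fin N → Bool)
    (i : Fin N) :
    Ensures X (isSeparated y r sel i)
      (fun b => b = true ↔ ∀ j, sel j = true → ¬ ∑ k, (y i k - y j k) ^ 2 ≤ r)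
      (N * (c * 4 + 3)) := by
  have hstep (j : Fin N) (ok : Bool) : Ensures X (if sel j = true then do
        let s ← sqDist (y i) (y j)
        let b ← le s r ret
        pure (ok && !b)
      else pure ok)
      (fun b => b = true ↔ ok = true ∧ (sel j = true → ¬ ∑ k, (y i k - y j k) ^ 2 ≤ r))
      (max (1 + c * 4 + (1 + 0)) 0) :=
    Ensures.ite (fun h => (ensures_sqDist _ _).bind_eq <| (ensures_le _ _).bind_eq <|
      Ensures.pure (by simp [h])) fun h => Ensures.pure (by simp [h])
  refine (ensures_loop_and hstep).mono (fun b hb => by simpa using hb) (le_of_eq ?_)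
  rw [max_eq_left (Nat.zero_le _)]
  ring

open Classical in
theorem ensures_greedyCluster {N c : ℕ} (y : Fin N → Fin c → ℝ) (thr rIn rOut : ℝ) :
    Ensures X (greedyCluster y thr rIn rOut)
      (IsGreedySelection (fun i => thr ≤ #{j | ∑ k, (y i k - y j k) ^ 2 ≤ rIn})
        (fun i j => ∑ k, (y i k - y j k) ^ 2 ≤ rOut) N)
      (N * (N * (c * 8 + 7) + 5)) := by
  have hsymm (i j : Fin N) : ∑ k, (y i k - y j k) ^ 2 = ∑ k, (y j k - y i k) ^ 2 :=
    sum_congr rfl fun k _ => sub_sq_comm _ _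
  have hstep (i : Fin N) (sel : Fin N → Bool)
      (hsel : IsGreedySelection (fun i => thr ≤ #{j | ∑ k, (y i k - y j k) ^ 2 ≤ rIn})
        (fun i j => ∑ k, (y i k - y j k) ^ 2 ≤ rOut) i sel) :
      Ensures X (do
        let cnt ← countClose y rIn i
        let dense ← le thr cnt ret
        let sep ← isSeparated y rOut sel i
        if dense && sep then do
          tick
          pure (Function.update sel i true)
        else pure sel)
      (IsGreedySelection (fun i => thr ≤ #{j | ∑ k, (y i k - y j k) ^ 2 ≤ rIn})
        (fun i j => ∑ k, (y i k - y j k) ^ 2 ≤ rOut) (i + 1))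
      (2 + N * (c * 4 + 4) + (1 + (N * (c * 4 + 3) + max (1 + 0) 0))) := by
    refine (ensures_countClose y rIn i).bind_eq <| (ensures_le _ _).bind_eq <|
      (ensures_isSeparated y rOut sel i).bind fun sep hsep =>
        Ensures.ite (fun h => ensures_tick.bind fun _ _ => Ensures.pure ?_)
          fun h => Ensures.pure ?_
    all_goals simp only [Bool.and_eq_true, decide_eq_true_eq, hsep] at h
    · exact hsel.select (fun j k hjk => (hsymm k j).trans_le hjk) h.1 h.2
    · refine hsel.skip fun hdense => ?_
      by_contra! hfar
      exact h ⟨hdense, fun j hj => (hfar j hj).not_ge⟩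
  refine (ensures_loop .zero hstep).mono (fun _ h => h) (le_of_eq ?_)
  rw [max_eq_left (Nat.zero_le _)]
  ring

end Prog

/-- The number `⌈36 log(2/δ)/α⌉` of points that `samplePostProcess` samples. -/
noncomputable def sampleSize (α δ : ℝ) : ℕ := ⌈36 * Real.log (2 / δ) / α⌉₊

/-- The dimension `⌈K log(1/(αδ))⌉` into which `samplePostProcess` projects. -/
noncomputable def sketchSize (K : ℕ) (α δ : ℝ) : ℕ := ⌈K * Real.log (1 / (α * δ))⌉₊

/-- The part of `samplePostProcess` that follows the random choices: project the sampled points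
and cluster the projections. -/
def clusterPhase {R : Type} {n d : ℕ} (α : R) (N c : ℕ) (pts : Fin N → Fin d → R)
    (G : Fin d → Fin c → R) : Prog R n d (Outcome R d) := do
  let y ← Prog.tabulate N fun i => Prog.project G (pts i)
  let dd ← Prog.ofNat d Prog.ret
  let a ← Prog.const (88 / 10) Prog.ret
  let rIn ← Prog.arith .mul a dd
  let b ← Prog.const (352 / 10) Prog.ret
  let rOut ← Prog.arith .mul b dd
  let NN ← Prog.ofNat N Prog.ret
  let p ← Prog.arith .mul α NN
  let three ← Prog.const 3 Prog.ret
  let thr ← Prog.arith .div p three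
  let sel ← Prog.greedyCluster y thr rIn rOut
  pure ⟨N, c, pts, G, sel⟩

theorem samplePostProcess_eq {R : Type} {n d : ℕ} (K : ℕ) (α δ : R) :
    (samplePostProcess K α δ : Prog R n d (Outcome R d)) =
      (Prog.sampleCount α δ >>= fun N => (Prog.tabulate N fun _ => Prog.samplePoint) >>= fun pts =>
        Prog.sketchDim K α δ >>= fun c => Prog.signMatrix c >>= fun G =>
          clusterPhase α N c pts G) := rfl

namespace Outcome

variable {d : ℕ} {o : Outcome ℝ d} {α : ℝ}

open Classical in
/-- The first condition on the members of a cluster set: after projection, at least `α N / 3` of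
the sampled points are close to the `i`-th one. -/
def IsDense (α : ℝ) (o : Outcome ℝ d) (i : Fin o.N) : Prop :=
  α * o.N / 3 ≤ (#{j | o.projSqDist i j ≤ 8.8 * d} : ℝ)

theorem projSqDist_eq_sum (o : Outcome ℝ d) (i j : Fin o.N) :
    o.projSqDist i j =
      ∑ k, (o.G.transpose.mulVec (o.pts i) k - o.G.transpose.mulVec (o.pts j) k) ^ 2 := by
  simp [projSqDist, EuclideanSpace.real_norm_sq_eq, Matrix.mulVec_sub]

theorem maximal_returned
    (h : IsGreedySelection (o.IsDense α) (fun i j => o.projSqDist i j ≤ 35.2 * d) o.N o.sel) :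
    Maximal (o.IsClusterSet α) o.returned := by
  have hmem : ∀ i, i ∈ o.returned ↔ o.sel i = true := fun i => by simp [returned]
  refine ⟨fun i hi => ⟨h.dense i ((hmem i).1 hi), fun j hj hji =>
    not_le.1 (h.not_close i j ((hmem i).1 hi) ((hmem j).1 hj) hji)⟩, fun L hL hle i hi => ?_⟩
  by_contra hni
  rw [hmem, Bool.not_eq_true] at hni
  obtain ⟨j, hj, hij⟩ := h.exists_close i i.2 (hL i hi).1 hni
  have hji : j ≠ i := fun hji => by simp [← hji, hj] at hni
  exact ((hL i hi).2 j (hle ((hmem j).2 hj)) hji).not_ge hij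

end Outcome

namespace Prog

variable {n d : ℕ} [NeZero n] {X : Fin n → EuclideanSpace ℝ (Fin d)}

theorem ensures_sampleCount (α δ : ℝ) : Ensures X (sampleCount α δ) (· = sampleSize α δ) 7 :=
  ((ensures_const 2).bind_eq <| (ensures_arith _ _ _).bind_eq <| (ensures_un _ _).bind_eq <|
    (ensures_const 36).bind_eq <| (ensures_arith _ _ _).bind_eq <| (ensures_arith _ _ _).bind_eq <|
    ensures_ceil _).mono (fun a ha => by simpa [BinOp.eval, UnOp.eval, sampleSize] using ha) le_rfl

theorem ensures_sketchDim (K : ℕ) (α δ : ℝ) :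
    Ensures X (sketchDim K α δ) (· = sketchSize K α δ) 7 :=
  ((ensures_const 1).bind_eq <| (ensures_arith _ _ _).bind_eq <| (ensures_arith _ _ _).bind_eq <|
    (ensures_un _ _).bind_eq <| (ensures_ofNat K).bind_eq <| (ensures_arith _ _ _).bind_eq <|
    ensures_ceil _).mono (fun a ha => by simpa [BinOp.eval, UnOp.eval, sketchSize] using ha) le_rfl

open Classical in
theorem ensures_clusterPhase (α : ℝ) (N c : ℕ) (pts : Fin N → Fin d → ℝ)
    (G : Matrix (Fin d) (Fin c) ℝ) :
    Ensures X (clusterPhase α N c pts G) (fun o : Outcome ℝ d => ∃ sel, o = ⟨N, c, pts, G, sel⟩ ∧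
        IsGreedySelection (o.IsDense α) (fun i j => o.projSqDist i j ≤ 35.2 * d) o.N o.sel)
      (N * (c * (d * 3 + 2) + 1) + 9 + N * (N * (c * 8 + 7) + 5)) := by
  refine ((ensures_tabulate fun i => ensures_project G (pts i)).bind (T := 9 + _) fun y hy =>
    ?_).mono (fun _ h => h) (le_of_eq (add_assoc _ _ _).symm)
  obtain rfl : y = fun i => G.transpose.mulVec (pts i) := funext hy
  refine Ensures.mono ((ensures_ofNat d).bind_eq <| (ensures_const _).bind_eq <|
    (ensures_arith _ _ _).bind_eq <| (ensures_const _).bind_eq <| (ensures_arith _ _ _).bind_eq <|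
    (ensures_ofNat N).bind_eq <| (ensures_arith _ _ _).bind_eq <| (ensures_const 3).bind_eq <|
    (ensures_arith _ _ _).bind_eq <| (ensures_greedyCluster _ _ _ _).bind fun sel hsel =>
      Ensures.pure ⟨sel, rfl, ?_⟩) (fun _ h => h) (le_of_eq (by ring))
  convert hsel using 3 <;> norm_num [BinOp.eval, Outcome.IsDense, Outcome.projSqDist_eq_sum]

/-- A bound on the number of steps of `samplePostProcess` with sample size `N` and sketch
dimension `c`. -/
def stepBound (d N c : ℕ) : ℕ :=
  7 + (N * (1 + d * 2 + 1) + (7 + (6 + d * (c * 2 + 1) +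
    (N * (c * (d * 3 + 2) + 1) + 9 + N * (N * (c * 8 + 7) + 5)))))

theorem ensures_samplePostProcess (K : ℕ) (α δ : ℝ) :
    Ensures X (samplePostProcess K α δ)
      (fun o => o.N = sampleSize α δ ∧ Maximal (o.IsClusterSet α) o.returned)
      (stepBound d (sampleSize α δ) (sketchSize K α δ)) := by
  rw [samplePostProcess_eq]
  refine (ensures_sampleCount α δ).bind_eq <|
    (ensures_tabulate (P := fun _ _ => True) fun _ => ensures_samplePoint).bind fun pts _ =>
    (ensures_sketchDim K α δ).bind_eq <| (ensures_signMatrix _).bind fun G _ =>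
    (ensures_clusterPhase α _ _ pts G).mono ?_ le_rfl
  rintro o ⟨sel, rfl, h⟩
  exact ⟨rfl, Outcome.maximal_returned h⟩

end Prog

/-! ### The joint law of the random choices -/

namespace Prog

variable {n d : ℕ} [NeZero n] {X : Fin n → EuclideanSpace ℝ (Fin d)} {A : Type}

theorem law_tabulate_succ (m : ℕ) (f : Fin (m + 1) → Prog ℝ n d A) :
    law X (tabulate (m + 1) f) =
      (law X (f 0)).bind fun a => (law X (tabulate m fun i => f i.succ)).map (Fin.cons a) := by
  have htick : law X (tick : Prog ℝ n d Unit) = PMF.pure () :=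
    (ensures_tick.mono (Q := (· = ())) (fun _ _ => rfl) le_rfl).law_eq_pure
  simp only [tabulate, law_bind, htick, PMF.pure_bind, law_pure]
  rfl

theorem toOuterMeasure_law_tabulate_pi : ∀ {m : ℕ} (f : Fin m → Prog ℝ n d A)
    (s : Fin m → Set A), (law X (tabulate m f)).toOuterMeasure (Set.univ.pi s) =
      ∏ i, (law X (f i)).toOuterMeasure (s i)
  | 0, f, s => by
    simp [tabulate, law_pure, Subsingleton.elim (default : Fin 0 → A) Fin.elim0]
  | m + 1, f, s => by
    classical
    have hcons (a : A) : Fin.cons a ⁻¹' Set.univ.pi s =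
        if a ∈ s 0 then Set.univ.pi fun i => s i.succ else (∅ : Set (Fin m → A)) := by
      ext v
      split_ifs with h <;> simp [Fin.forall_fin_succ, h]
    rw [law_tabulate_succ, PMF.toOuterMeasure_bind_apply, Fin.prod_univ_succ,
      ← toOuterMeasure_law_tabulate_pi, PMF.toOuterMeasure_apply, ← ENNReal.tsum_mul_right]
    refine tsum_congr fun a => ?_
    rw [PMF.toOuterMeasure_map_apply, hcons]
    by_cases h : a ∈ s 0 <;> simp [h]

theorem toMeasure_law_tabulate [MeasurableSpace A] {m : ℕ} (f : Fin m → Prog ℝ n d A) :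
    (law X (tabulate m f)).toMeasure = Measure.pi fun i => (law X (f i)).toMeasure := by
  refine (Measure.pi_eq fun s hs => ?_).symm
  rw [PMF.toMeasure_apply_eq_toOuterMeasure_apply _ (.univ_pi hs), toOuterMeasure_law_tabulate_pi]
  exact prod_congr rfl fun i _ => (PMF.toMeasure_apply_eq_toOuterMeasure_apply _ (hs i)).symm

theorem law_samplePoint :
    law X samplePoint = (PMF.uniformOfFintype (Fin n)).map fun i => (X i).ofLp := by
  have hcopy (i : Fin n) : law X (tabulate d fun j => read i j ret) = PMF.pure (X i).ofLp :=
    ((ensures_tabulate fun j => ensures_read i j).mono (Q := (· = (X i).ofLp))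
      (fun _ => funext) le_rfl).law_eq_pure
  simp only [samplePoint, law_bind, law_sample, hcopy]
  rfl

theorem measureReal_law_samplePoint {s : Set (Fin d → ℝ)} (hs : MeasurableSet s)
    [DecidablePred fun i => (X i).ofLp ∈ s] :
    (law X samplePoint).toMeasure.real s = (#{i | (X i).ofLp ∈ s} : ℝ) / n := by
  let _ : Fintype ((fun i => (X i).ofLp) ⁻¹' s) := Subtype.fintype fun i => (X i).ofLp ∈ s
  rw [law_samplePoint, measureReal_def, PMF.toMeasure_map_apply _ _ _ (by fun_prop) hs,
    PMF.toMeasure_uniformOfFintype_apply _ .of_discrete, Fintype.card_fin, ENNReal.toReal_div,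
    ENNReal.toReal_natCast, ENNReal.toReal_natCast, ← Fintype.card_subtype]
  rfl

end Prog

/-- The uniform law on `{±1/√c}`. -/
noncomputable def signLaw (c : ℕ) : PMF ℝ :=
  (PMF.uniformOfFintype Bool).map fun b => if b then 1 / √c else -(1 / √c)

theorem integral_signLaw {E : Type*} [NormedAddCommGroup E] [NormedSpace ℝ E] [CompleteSpace E]
    (c : ℕ) {f : ℝ → E} (hf : StronglyMeasurable f) :
    ∫ x, f x ∂(signLaw c).toMeasure = (2⁻¹ : ℝ) • (f (1 / √c) + f (-(1 / √c))) := by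
  rw [signLaw, ← PMF.toMeasure_map _ _ (by fun_prop),
    integral_map (by fun_prop) hf.aestronglyMeasurable, PMF.integral_eq_sum]
  simp

theorem hasSubgaussianMGF_signLaw (c : ℕ) :
    HasSubgaussianMGF id (c : ℝ≥0)⁻¹ (signLaw c).toMeasure := by
  have hmem : ∀ᵐ x ∂(signLaw c).toMeasure, x ∈ Set.Icc (-(1 / √c)) (1 / √c) := by
    rw [signLaw, ← PMF.toMeasure_map _ _ (by fun_prop), ae_map_iff (by fun_prop)
      (by exact measurableSet_Icc)]
    refine ae_of_all _ fun b => ?_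
    cases b <;> simp
  have hmean : ∫ x, id x ∂(signLaw c).toMeasure = 0 := by
    rw [integral_signLaw c stronglyMeasurable_id]
    simp
  convert hasSubgaussianMGF_of_mem_Icc_of_integral_eq_zero aemeasurable_id hmem hmean
  ext
  have h : (1 / √(c : ℝ)) ^ 2 = (c : ℝ)⁻¹ := by simp
  push_cast
  rw [sub_neg_eq_add, ← two_mul, Real.norm_eq_abs, div_pow, sq_abs, ← h]
  ring

namespace Prog

variable {n d : ℕ} [NeZero n] {X : Fin n → EuclideanSpace ℝ (Fin d)}

theorem toMeasure_law_signMatrix (c : ℕ) : (law X (signMatrix c)).toMeasure =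
    Measure.pi fun _ => Measure.pi fun _ => (signLaw c).toMeasure := by
  have hentry (pos neg : ℝ) : law X (coin ret >>= fun b => pure (if b then pos else neg)) =
      (PMF.uniformOfFintype Bool).map fun b => if b then pos else neg := by
    rw [law_bind, law_coin]
    simp only [law_pure]
    rfl
  rw [signMatrix, (ensures_ofNat c).law_bind_eq, (ensures_un _ _).law_bind_eq,
    (ensures_const 1).law_bind_eq, (ensures_const 0).law_bind_eq,
    (ensures_arith _ _ _).law_bind_eq, (ensures_arith _ _ _).law_bind_eq]
  simp only [toMeasure_law_tabulate, hentry]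
  simp [signLaw, BinOp.eval, UnOp.eval]

theorem iIndepFun_signMatrix (c : ℕ) :
    iIndepFun (fun (p : Fin d × Fin c) (G : Fin d → Fin c → ℝ) => G p.1 p.2)
      (law X (signMatrix c)).toMeasure := by
  have h := iIndepFun_uncurry_infinitePi' (ι := Fin d) (κ := Fin c) (X := fun _ _ => id)
    (μ := fun _ _ => (signLaw c).toMeasure) (fun _ _ => measurable_id)
  simp only [Measure.infinitePi_eq_pi] at h
  rw [toMeasure_law_signMatrix]
  exact h

theorem measurePreserving_signMatrix_entry (c : ℕ) (i : Fin d) (k : Fin c) :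
    MeasurePreserving (fun G : Fin d → Fin c → ℝ => G i k)
      (law X (signMatrix c)).toMeasure (signLaw c).toMeasure := by
  rw [toMeasure_law_signMatrix]
  exact (measurePreserving_eval (fun _ => (signLaw c).toMeasure) k).comp
    (measurePreserving_eval (fun _ => Measure.pi fun _ => (signLaw c).toMeasure) i)

theorem measureReal_signMatrix_lt_abs_le {c : ℕ} (hc : c ≠ 0) (x : EuclideanSpace ℝ (Fin d))
    {ε : ℝ} (hε : 0 ≤ ε) (hε1 : ε ≤ 1) :
    (law X (signMatrix c)).toMeasure.real
        {G | ε * ‖x‖ ^ 2 < |∑ k, (Matrix.of G).transpose.mulVec x k ^ 2 - ‖x‖ ^ 2|} ≤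
      2 * Real.exp (-(ε ^ 2 / 32 * c)) := by
  let P := (law X (signMatrix c)).toMeasure
  have hentry := measurePreserving_signMatrix_entry (X := X) c
  have hint {f : ℝ → ℝ} (hf : StronglyMeasurable f) (i : Fin d) (k : Fin c) :
      ∫ G : Fin d → Fin c → ℝ, f (G i k) ∂P = 2⁻¹ * (f (1 / √c) + f (-(1 / √c))) := by
    rw [← smul_eq_mul, ← integral_signLaw c hf, ← (hentry i k).map_eq,
      integral_map (hentry i k).aemeasurable hf.aestronglyMeasurable]
  have hsub (i : Fin d) (k : Fin c) :
      HasSubgaussianMGF (fun G : Fin d → Fin c → ℝ => G i k) (c : ℝ≥0)⁻¹ P :=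
    HasSubgaussianMGF.of_map (X := id) (hentry i k).aemeasurable <|
      (hentry i k).map_eq ▸ hasSubgaussianMGF_signLaw c
  have hJL := measureReal_lt_abs_sum_mulVec_transpose_sq_sub_le (μ := P)
    (G := fun G : Fin d → Fin c → ℝ => Matrix.of G) (v := (c : ℝ≥0)⁻¹)
    (fun i k => (hentry i k).measurable) (iIndepFun_signMatrix c) hsub
    (fun i k => by simpa using hint stronglyMeasurable_id i k)
    (fun i k => (hint (f := fun y => y ^ 2) (by fun_prop) i k).trans (by simp; ring)) x hε hε1
  have hc' : (c : ℝ) * (‖x‖ ^ 2 * ((c : ℝ≥0)⁻¹ : ℝ≥0)) = ‖x‖ ^ 2 := by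
    push_cast
    field_simp
  simpa only [Fintype.card_fin, hc'] using hJL

end Prog

/-- The map `x ↦ Gᵀ x` changes the squared norm of `x` by at most a fraction `ε`. -/
def PreservesSqNorm {ι κ : Type*} [Fintype ι] [Fintype κ] (ε : ℝ) (G : Matrix ι κ ℝ)
    (x : EuclideanSpace ℝ ι) : Prop :=
  |∑ k, G.transpose.mulVec x k ^ 2 - ‖x‖ ^ 2| ≤ ε * ‖x‖ ^ 2

namespace Prog

variable {n d : ℕ} [NeZero n] {X : Fin n → EuclideanSpace ℝ (Fin d)}

theorem measureReal_tabulate_samplePoint_card_le {s : Set (Fin d → ℝ)} (hs : MeasurableSet s)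
    [DecidablePred (· ∈ s)] {p ε : ℝ} (hp : p * n ≤ #{i | (X i).ofLp ∈ s}) (hε : 0 ≤ ε)
    (hε1 : ε ≤ 1) (N : ℕ) :
    (law X (tabulate N fun _ => samplePoint)).toMeasure.real
        {x | (#{j | x j ∈ s} : ℝ) ≤ (1 - ε) * (N * p)} ≤ Real.exp (-(ε ^ 2 / 2 * (N * p))) := by
  have hn : (0 : ℝ) < n := by exact_mod_cast NeZero.pos n
  rw [toMeasure_law_tabulate]
  simpa only [Fintype.card_fin] using measureReal_pi_card_le_exp (ι := Fin N) hs
    (((le_div_iff₀ hn).2 hp).trans_eq (measureReal_law_samplePoint hs).symm) hε hε1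

theorem measureReal_signMatrix_not_preservesSqNorm_le {c : ℕ} (hc : c ≠ 0) {ι : Type*} [Fintype ι]
    (x : ι → EuclideanSpace ℝ (Fin d)) {ε : ℝ} (hε : 0 ≤ ε) (hε1 : ε ≤ 1) :
    (law X (signMatrix c)).toMeasure.real {G | ¬ ∀ i, PreservesSqNorm ε (Matrix.of G) (x i)} ≤
      Fintype.card ι * (2 * Real.exp (-(ε ^ 2 / 32 * c))) := by
  have hunion : {G : Fin d → Fin c → ℝ | ¬ ∀ i, PreservesSqNorm ε (Matrix.of G) (x i)} =
      ⋃ i, {G | ¬ PreservesSqNorm ε (Matrix.of G) (x i)} := by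
    ext G
    simp
  calc _ ≤ ∑ i, (law X (signMatrix c)).toMeasure.real
          {G | ¬ PreservesSqNorm ε (Matrix.of G) (x i)} :=
        hunion ▸ measureReal_iUnion_fintype_le _
    _ ≤ ∑ _i : ι, 2 * Real.exp (-(ε ^ 2 / 32 * c)) := sum_le_sum fun i _ => by
        simpa only [PreservesSqNorm, not_le] using
          measureReal_signMatrix_lt_abs_le hc (x i) hε hε1
    _ = Fintype.card ι * (2 * Real.exp (-(ε ^ 2 / 32 * c))) := by simp

end Prog

/-! ### Failure probabilities -/

section FailureProbability

variable {A B : Type*} {p : PMF A}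

theorem toOuterMeasure_le_ofReal [MeasurableSpace A] {s : Set A} {ε : ℝ}
    (h : p.toMeasure.real s ≤ ε) : p.toOuterMeasure s ≤ ENNReal.ofReal ε :=
  (p.toOuterMeasure_apply_le_toMeasure_apply s).trans <|
    ENNReal.le_ofReal_iff_toReal_le (measure_ne_top _ _) (measureReal_nonneg.trans h) |>.2 h

theorem toOuterMeasure_bind_le {f : A → PMF B} {s : Set A} {t : Set B} {ε η : ℝ≥0∞}
    (hs : p.toOuterMeasure s ≤ ε) (ht : ∀ a ∉ s, (f a).toOuterMeasure t ≤ η) :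
    (p.bind f).toOuterMeasure t ≤ ε + η := by
  classical
  have hterm (a : A) : p a * (f a).toOuterMeasure t ≤ s.indicator p a + p a * η := by
    by_cases ha : a ∈ s
    · have h1 : (f a).toOuterMeasure t ≤ 1 :=
        ((f a).toOuterMeasure.mono (Set.subset_univ t)).trans_eq <|
          (PMF.toOuterMeasure_apply_eq_one_iff _ _).2 (Set.subset_univ _)
      rw [Set.indicator_of_mem ha]
      exact (mul_le_of_le_one_right' h1).trans le_self_add
    · exact (mul_le_mul_right (ht a ha) _).trans le_add_self
  calc (p.bind f).toOuterMeasure t = ∑' a, p a * (f a).toOuterMeasure t :=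
        PMF.toOuterMeasure_bind_apply _ _ _
    _ ≤ ∑' a, (s.indicator p a + p a * η) := ENNReal.tsum_le_tsum hterm
    _ = p.toOuterMeasure s + η := by
        rw [ENNReal.tsum_add, ENNReal.tsum_mul_right, PMF.tsum_coe, one_mul,
          PMF.toOuterMeasure_apply]
    _ ≤ ε + η := by gcongr

theorem one_sub_le_toOuterMeasure {s : Set A} {ε : ℝ≥0∞} (h : p.toOuterMeasure sᶜ ≤ ε) :
    1 - ε ≤ p.toOuterMeasure s := by
  rw [tsub_le_iff_right, ← (p.toOuterMeasure_apply_eq_one_iff Set.univ).2 (Set.subset_univ _),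
    ← Set.union_compl_self s]
  exact (measure_union_le s sᶜ).trans (by gcongr)

end FailureProbability

/-! ### Cluster sets -/

theorem norm_sub_sq_le {E : Type*} [SeminormedAddCommGroup E] (a b c : E) :
    ‖a - b‖ ^ 2 ≤ 2 * (‖a - c‖ ^ 2 + ‖b - c‖ ^ 2) :=
  calc ‖a - b‖ ^ 2 ≤ (‖a - c‖ + ‖b - c‖) ^ 2 := by
        gcongr
        exact (norm_sub_le_norm_sub_add_norm_sub a c b).trans_eq (by rw [norm_sub_rev c b])
    _ ≤ 2 * (‖a - c‖ ^ 2 + ‖b - c‖ ^ 2) := add_sq_le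

namespace Outcome

variable {d : ℕ} {o : Outcome ℝ d} {α : ℝ} {L : Finset (Fin o.N)}

theorem projSqDist_eq_norm_sub_sq (o : Outcome ℝ d) (i j : Fin o.N) :
    o.projSqDist i j = ‖WithLp.toLp 2 (o.G.transpose.mulVec (o.pts i)) -
      WithLp.toLp 2 (o.G.transpose.mulVec (o.pts j))‖ ^ 2 := by
  rw [projSqDist, Matrix.mulVec_sub, WithLp.toLp_sub]

theorem projSqDist_comm (o : Outcome ℝ d) (i j : Fin o.N) :
    o.projSqDist i j = o.projSqDist j i := by
  simp only [projSqDist_eq_norm_sub_sq, norm_sub_rev]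

theorem projSqDist_self (o : Outcome ℝ d) (i : Fin o.N) : o.projSqDist i i = 0 := by
  simp [projSqDist_eq_norm_sub_sq]

theorem projSqDist_le (o : Outcome ℝ d) (i j k : Fin o.N) :
    o.projSqDist i j ≤ 2 * (o.projSqDist i k + o.projSqDist j k) := by
  simpa only [projSqDist_eq_norm_sub_sq] using norm_sub_sq_le _ _ _

open Classical in
theorem IsClusterSet.pairwiseDisjoint (hL : o.IsClusterSet α L) :
    (L : Set (Fin o.N)).PairwiseDisjoint
      fun i => ({j | o.projSqDist i j ≤ 8.8 * d} : Finset (Fin o.N)) := by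
  refine fun i hi j hj hij => disjoint_left.2 fun k hik hjk => ?_
  have hfar := (hL i hi).2 j hj hij.symm
  have hik : o.projSqDist i k ≤ 8.8 * d := (mem_filter.1 hik).2
  have hjk : o.projSqDist j k ≤ 8.8 * d := (mem_filter.1 hjk).2
  linarith [o.projSqDist_le i j k]

theorem IsClusterSet.card_le (hL : o.IsClusterSet α L) (hα : 0 < α) (hN : o.N ≠ 0) :
    (#L : ℝ) ≤ 3 / α := by
  classical
  have hN' : (0 : ℝ) < o.N := by positivity
  have hcount : #L * (α * o.N / 3) ≤ o.N :=
    calc #L * (α * o.N / 3) = ∑ _i ∈ L, α * o.N / 3 := by simp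
      _ ≤ ∑ i ∈ L, (#{j | o.projSqDist i j ≤ 8.8 * d} : ℝ) := sum_le_sum fun i hi => (hL i hi).1
      _ = #(L.biUnion fun i => {j | o.projSqDist i j ≤ 8.8 * d}) := by
          rw [card_biUnion hL.pairwiseDisjoint, Nat.cast_sum]
      _ ≤ o.N := by exact_mod_cast (card_le_univ _).trans_eq (Fintype.card_fin _)
  rw [le_div_iff₀ hα]
  refine le_of_mul_le_mul_right ?_ hN'
  linarith

theorem exists_projSqDist_le_of_maximal (hL : Maximal (o.IsClusterSet α) L) {i : Fin o.N}
    (hi : o.IsDense α i) : ∃ j ∈ L, o.projSqDist i j ≤ 35.2 * d := by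
  classical
  by_contra! hfar
  have hins : o.IsClusterSet α (insert i L) := by
    simp only [IsClusterSet, forall_mem_insert]
    refine ⟨⟨hi, fun h => absurd rfl h, fun j hj _ => hfar j hj⟩, fun k hk => ⟨(hL.1 k hk).1,
      fun _ => projSqDist_comm o i k ▸ hfar k hk, (hL.1 k hk).2⟩⟩
  have hself := hfar i (hL.2 hins (subset_insert i L) (mem_insert_self i L))
  rw [projSqDist_self] at hself
  exact hself.not_ge (by positivity)

open Classical in
theorem exists_norm_sub_sq_le {μ : EuclideanSpace ℝ (Fin d)}
    (hpos : 0 < α * o.N)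
    (hnear : α * o.N / 3 ≤ (#{i | ‖WithLp.toLp 2 (o.pts i) - μ‖ ^ 2 ≤ 2 * d} : ℝ))
    (hproj : ∀ i j,
      PreservesSqNorm (1 / 10) o.G (WithLp.toLp 2 (o.pts i) - WithLp.toLp 2 (o.pts j)))
    (hL : Maximal (o.IsClusterSet α) L) :
    ∃ i ∈ L, ‖WithLp.toLp 2 (o.pts i) - μ‖ ^ 2 ≤ 100 * d := by
  let x (i : Fin o.N) : EuclideanSpace ℝ (Fin d) := WithLp.toLp 2 (o.pts i)
  have hproj' (i j : Fin o.N) :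
      |o.projSqDist i j - ‖x i - x j‖ ^ 2| ≤ 1 / 10 * ‖x i - x j‖ ^ 2 := by
    rw [projSqDist, EuclideanSpace.real_norm_sq_eq]
    exact hproj i j
  obtain ⟨i, hi⟩ : ({i | ‖x i - μ‖ ^ 2 ≤ 2 * d} : Finset (Fin o.N)).Nonempty := by
    rw [← card_pos, ← Nat.cast_pos (α := ℝ)]
    exact (div_pos hpos three_pos).trans_le hnear
  replace hi : ‖x i - μ‖ ^ 2 ≤ 2 * d := (mem_filter.1 hi).2
  have hdense : o.IsDense α i := by
    refine hnear.trans (Nat.cast_le.2 (card_le_card (monotone_filter_right _ fun j _ hj => ?_)))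
    have hij := norm_sub_sq_le (x i) (x j) μ
    have hupper := (abs_le.1 (hproj' i j)).2
    linarith
  obtain ⟨j, hj, hij⟩ := exists_projSqDist_le_of_maximal hL hdense
  refine ⟨j, hj, (?_ : ‖x j - μ‖ ^ 2 ≤ 100 * d)⟩
  have hjμ := norm_sub_sq_le (x j) μ (x i)
  have hlower := (abs_le.1 (hproj' i j)).1
  rw [norm_sub_rev (x j) (x i), norm_sub_rev μ] at hjμ
  linarith [Nat.cast_nonneg (α := ℝ) d]

end Outcome

/-! ### Inliers -/

theorem card_filter_lt_mul_le_sum {ι : Type*} {s : Finset ι} {f : ι → ℝ} (hf : ∀ i ∈ s, 0 ≤ f i)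
    (t : ℝ) : #{i ∈ s | t < f i} * t ≤ ∑ i ∈ s, f i :=
  calc #{i ∈ s | t < f i} * t = ∑ i ∈ s with t < f i, t := by simp
    _ ≤ ∑ i ∈ s with t < f i, f i := sum_le_sum fun i hi => (mem_filter.1 hi).2.le
    _ ≤ ∑ i ∈ s, f i :=
      sum_le_sum_of_subset_of_nonneg (filter_subset _ _) fun i hi _ => hf i hi

namespace HasInliers

variable {n d : ℕ} {X : Fin n → EuclideanSpace ℝ (Fin d)} {α : ℝ} {μ : EuclideanSpace ℝ (Fin d)}

theorem exists_sum_norm_sub_sq_le (h : HasInliers X α μ) :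
    ∃ S : Finset (Fin n), α * n ≤ #S ∧ ∑ i ∈ S, ‖X i - μ‖ ^ 2 ≤ #S * d := by
  obtain ⟨S, hS, hpsd⟩ := h
  refine ⟨S, hS, ?_⟩
  have htrace (i : Fin n) :
      (Matrix.vecMulVec (X i - μ).ofLp (X i - μ).ofLp).trace = ‖X i - μ‖ ^ 2 := by
    simp [Matrix.trace_vecMulVec, EuclideanSpace.real_norm_sq_eq, dotProduct, ← sq]
  have hmean : (#S : ℝ)⁻¹ * ∑ i ∈ S, ‖X i - μ‖ ^ 2 ≤ d := by
    simpa only [Matrix.trace_sub, Matrix.trace_one, Matrix.trace_smul, Matrix.trace_sum, htrace,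
      Fintype.card_fin, smul_eq_mul, sub_nonneg] using hpsd.trace_nonneg
  rcases S.eq_empty_or_nonempty with rfl | hne
  · simp
  · rwa [inv_mul_le_iff₀ (by exact_mod_cast hne.card_pos)] at hmean

theorem half_mul_le_card (h : HasInliers X α μ) (hd : d ≠ 0) :
    α / 2 * n ≤ #{i | ‖X i - μ‖ ^ 2 ≤ 2 * d} := by
  obtain ⟨S, hS, hsum⟩ := h.exists_sum_norm_sub_sq_le
  have hfar : (#{i ∈ S | 2 * d < ‖X i - μ‖ ^ 2} : ℝ) ≤ #S / 2 := by
    have hd' : (0 : ℝ) < 2 * d := by positivity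
    refine le_of_mul_le_mul_right ?_ hd'
    linarith [card_filter_lt_mul_le_sum (s := S) (fun i _ => sq_nonneg ‖X i - μ‖) (2 * d)]
  have hsplit : (#{i ∈ S | ‖X i - μ‖ ^ 2 ≤ 2 * d} : ℝ) + #{i ∈ S | 2 * d < ‖X i - μ‖ ^ 2} = #S := by
    simp only [← not_le]
    exact_mod_cast card_filter_add_card_filter_not _
  have hnear : (#{i ∈ S | ‖X i - μ‖ ^ 2 ≤ 2 * d} : ℝ) ≤ #{i | ‖X i - μ‖ ^ 2 ≤ 2 * d} := by
    gcongr
    exact subset_univ S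
  linarith

end HasInliers

/-! ### Parameters -/

theorem Prog.stepBound_le {d N c : ℕ} (hd : d ≠ 0) (hN : N ≠ 0) (hc : c ≠ 0) :
    Prog.stepBound d N c ≤ 50 * (N * c * (N + d)) := by
  obtain ⟨d, rfl⟩ := Nat.exists_eq_succ_of_ne_zero hd
  obtain ⟨N, rfl⟩ := Nat.exists_eq_succ_of_ne_zero hN
  obtain ⟨c, rfl⟩ := Nat.exists_eq_succ_of_ne_zero hc
  zify
  refine sub_nonneg.1 ?_
  push_cast [Prog.stepBound]
  ring_nf
  positivity

section Parameters

theorem le_one_div_mul_comm {a b c : ℝ} (ha : 0 < a) (hb : 0 < b) (hc : 0 < c)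
    (h : a ≤ 1 / (c * b)) : b ≤ 1 / (c * a) := by
  rw [le_div_iff₀ (by positivity)] at h ⊢
  linarith

variable {α δ : ℝ}

theorem half_lt_log_two_div (hδ : 0 < δ) (hδ1 : δ ≤ 1) : 1 / 2 < Real.log (2 / δ) :=
  calc (1 / 2 : ℝ) < Real.log 2 := by linarith [Real.log_two_gt_d9]
    _ ≤ Real.log (2 / δ) := by
      gcongr
      exact le_div_self two_pos.le hδ hδ1

theorem log_two_div_le_log_one_div (hα : 0 < α) (hα2 : α ≤ 1 / 2) (hδ : 0 < δ) :
    Real.log (2 / δ) ≤ Real.log (1 / (α * δ)) := by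
  rw [← div_div]
  gcongr
  rwa [le_one_div two_pos hα]

theorem half_lt_log_one_div (hα : 0 < α) (hα2 : α ≤ 1 / 2) (hδ : 0 < δ) (hδ1 : δ ≤ 1) :
    1 / 2 < Real.log (1 / (α * δ)) :=
  (half_lt_log_two_div hδ hδ1).trans_le (log_two_div_le_log_one_div hα hα2 hδ)

theorem sampleSize_ne_zero (hα : 0 < α) (hδ : 0 < δ) (hδ1 : δ ≤ 1) : sampleSize α δ ≠ 0 := by
  have hlog := one_half_pos.trans (half_lt_log_two_div hδ hδ1)
  exact (Nat.ceil_pos.2 (by positivity)).ne'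

theorem sketchSize_ne_zero {K : ℕ} (hK : K ≠ 0) (hα : 0 < α) (hα2 : α ≤ 1 / 2) (hδ : 0 < δ)
    (hδ1 : δ ≤ 1) : sketchSize K α δ ≠ 0 := by
  have hlog := one_half_pos.trans (half_lt_log_one_div hα hα2 hδ hδ1)
  exact (Nat.ceil_pos.2 (by positivity)).ne'

theorem sampleSize_le (hα : 0 < α) (hα2 : α ≤ 1 / 2) (hδ : 0 < δ) (hδ1 : δ ≤ 1) :
    (sampleSize α δ : ℝ) ≤ 38 * Real.log (1 / (α * δ)) / α := by
  have hlog := half_lt_log_two_div hδ hδ1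
  have hlog' := log_two_div_le_log_one_div hα hα2 hδ
  calc (sampleSize α δ : ℝ) ≤ 36 * Real.log (2 / δ) / α + 1 :=
        (Nat.ceil_lt_add_one (div_nonneg (by linarith) hα.le)).le
    _ = (36 * Real.log (2 / δ) + α) / α := div_add_one hα.ne'
    _ ≤ 38 * Real.log (1 / (α * δ)) / α := by
        gcongr
        linarith

theorem sketchSize_le (K : ℕ) (hα : 0 < α) (hα2 : α ≤ 1 / 2) (hδ : 0 < δ) (hδ1 : δ ≤ 1) :
    (sketchSize K α δ : ℝ) ≤ (K + 2) * Real.log (1 / (α * δ)) := by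
  have hlog := half_lt_log_one_div hα hα2 hδ hδ1
  have hceil : (sketchSize K α δ : ℝ) < K * Real.log (1 / (α * δ)) + 1 :=
    Nat.ceil_lt_add_one (by positivity)
  linarith

theorem exp_neg_sampleSize_le (hα : 0 < α) (hδ : 0 < δ) :
    Real.exp (-(α * sampleSize α δ / 36)) ≤ δ / 2 := by
  have hceil : 36 * Real.log (2 / δ) / α ≤ sampleSize α δ := Nat.le_ceil _
  rw [div_le_iff₀ hα] at hceil
  calc Real.exp (-(α * sampleSize α δ / 36)) ≤ Real.exp (-Real.log (2 / δ)) := by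
        gcongr
        linarith
    _ = δ / 2 := by rw [Real.exp_neg, Real.exp_log (by positivity), inv_div]

theorem exp_neg_sketchSize_div_le {K m D : ℕ} (hK : m * D ≤ K) (hD : D ≠ 0) (hα : 0 < α)
    (hα2 : α ≤ 1 / 2) (hδ : 0 < δ) (hδ1 : δ ≤ 1) :
    Real.exp (-(sketchSize K α δ / D)) ≤ (α * δ) ^ m := by
  have hlog := half_lt_log_one_div hα hα2 hδ hδ1
  have hmul : m * Real.log (1 / (α * δ)) ≤ sketchSize K α δ / D := by
    rw [le_div_iff₀ (by positivity)]
    calc m * Real.log (1 / (α * δ)) * D = (m * D : ℕ) * Real.log (1 / (α * δ)) := by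
          push_cast
          ring
      _ ≤ K * Real.log (1 / (α * δ)) := by gcongr
      _ ≤ sketchSize K α δ := Nat.le_ceil _
  calc Real.exp (-(sketchSize K α δ / D)) ≤ Real.exp (-(m * Real.log (1 / (α * δ)))) := by gcongr
    _ = (α * δ) ^ m := by
      rw [one_div, Real.log_inv, mul_neg, neg_neg, Real.exp_nat_mul, Real.exp_log (by positivity)]

-- The rate `1 / 3200` is `ε ^ 2 / 32` for `ε = 1 / 10`. Of the 18 powers of `α * δ`, four pay for
-- the square of the sample size, one for `δ` and the others for the numerical constant.
theorem sampleSize_sq_mul_exp_neg_sketchSize_le {K : ℕ} (hK : 18 * 3200 ≤ K) (hα : 0 < α)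
    (hα2 : α ≤ 1 / 2) (hδ : 0 < δ) (hδ1 : δ ≤ 1) :
    (sampleSize α δ : ℝ) ^ 2 * (2 * Real.exp (-(sketchSize K α δ / 3200))) ≤ δ / 2 := by
  set a := α * δ
  have ha0 : 0 < a := mul_pos hα hδ
  have haα : a ≤ α := mul_le_of_le_one_right hα.le hδ1
  have haδ : a ≤ δ := mul_le_of_le_one_left hδ.le (hα2.trans one_half_lt_one.le)
  have hN : (sampleSize α δ : ℝ) ≤ 38 / a ^ 2 :=
    calc (sampleSize α δ : ℝ) ≤ 38 * Real.log (1 / a) / α := sampleSize_le hα hα2 hδ hδ1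
      _ ≤ 38 * (1 / a) / a := by
          gcongr
          exact Real.log_le_self (by positivity)
      _ = 38 / a ^ 2 := by ring
  have hexp : Real.exp (-(sketchSize K α δ / 3200)) ≤ a ^ 18 := by
    exact_mod_cast exp_neg_sketchSize_div_le (D := 3200) hK (by norm_num) hα hα2 hδ hδ1
  calc _ ≤ (38 / a ^ 2) ^ 2 * (2 * a ^ 18) := by gcongr
    _ = 2888 * a ^ 13 * a := by
        field_simp
        norm_num
    _ ≤ 2888 * (1 / 2) ^ 13 * δ := by
        gcongr
        exact haα.trans hα2
    _ ≤ δ / 2 := by linarith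

theorem stepBound_sampleSize_sketchSize_le {C : ℝ} {K d : ℕ} (hC : 0 < C) (hK : K ≠ 0)
    (hd : d ≠ 0) (hα : 0 < α) (hα2 : α ≤ 1 / 2) (hαd : α ≤ 1 / (C * d)) (hδ : 0 < δ)
    (hδ1 : δ ≤ 1) :
    (Prog.stepBound d (sampleSize α δ) (sketchSize K α δ) : ℝ) ≤
      3800 * (K + 2) * (38 + 2 / C) * (1 / α ^ 2 * Real.log (1 / (α * δ)) ^ 4) := by
  have hlog := half_lt_log_one_div hα hα2 hδ hδ1
  have hN := sampleSize_le hα hα2 hδ hδ1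
  have hc := sketchSize_le K hα hα2 hδ hδ1
  have hbound := Prog.stepBound_le hd (sampleSize_ne_zero hα hδ hδ1)
    (sketchSize_ne_zero hK hα hα2 hδ hδ1)
  set l := Real.log (1 / (α * δ))
  have hdα := le_one_div_mul_comm hα (by positivity : (0 : ℝ) < d) hC hαd
  have hsum : (sampleSize α δ + d : ℝ) ≤ (38 + 2 / C) * l / α :=
    calc (sampleSize α δ + d : ℝ) ≤ 38 * l / α + 1 / (C * α) := add_le_add hN hdα
      _ = (38 * l + 1 / C) / α := by field_simp
      _ ≤ (38 * l + 1 / C * (2 * l)) / α := by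
          gcongr
          exact le_mul_of_one_le_right (by positivity) (by linarith)
      _ = (38 + 2 / C) * l / α := by ring
  calc (Prog.stepBound d (sampleSize α δ) (sketchSize K α δ) : ℝ)
      ≤ 50 * (sampleSize α δ * sketchSize K α δ * (sampleSize α δ + d)) := by
        exact_mod_cast hbound
    _ ≤ 50 * (38 * l / α * ((K + 2) * l) * ((38 + 2 / C) * l / α)) := by gcongr
    _ = 1900 * (K + 2) * (38 + 2 / C) * (1 / α ^ 2 * l ^ 3) := by ring
    _ ≤ 1900 * (K + 2) * (38 + 2 / C) * (1 / α ^ 2 * (l ^ 3 * (2 * l))) := by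
        gcongr
        exact le_mul_of_one_le_right (by positivity) (by linarith)
    _ = 3800 * (K + 2) * (38 + 2 / C) * (1 / α ^ 2 * l ^ 4) := by ring

end Parameters

/-! ### The success probability -/

namespace Prog

variable {n d : ℕ} [NeZero n] {X : Fin n → EuclideanSpace ℝ (Fin d)}
  {μ : EuclideanSpace ℝ (Fin d)} {α δ : ℝ} {K : ℕ}

theorem law_samplePostProcess (K : ℕ) (α δ : ℝ) :
    law X (samplePostProcess K α δ) =
      (law X (tabulate (sampleSize α δ) fun _ => samplePoint)).bind fun pts =>
        (law X (signMatrix (sketchSize K α δ))).bind fun G => law X (clusterPhase α _ _ pts G) := by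
  rw [samplePostProcess_eq, (ensures_sampleCount α δ).law_bind_eq, law_bind]
  simp only [(ensures_sketchDim K α δ).law_bind_eq, law_bind]

open Classical in
theorem toOuterMeasure_tabulate_samplePoint_card_le (hX : HasInliers X α μ) (hd : d ≠ 0) (N : ℕ) :
    (law X (tabulate N fun _ => samplePoint)).toOuterMeasure
        {x | (#{j | ‖WithLp.toLp 2 (x j) - μ‖ ^ 2 ≤ 2 * d} : ℝ) ≤ α * N / 3} ≤
      ENNReal.ofReal (Real.exp (-(α * N / 36))) := by
  have hmeas : MeasurableSet {x : Fin d → ℝ | ‖WithLp.toLp 2 x - μ‖ ^ 2 ≤ 2 * d} :=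
    measurableSet_le (by fun_prop) measurable_const
  have hchernoff := measureReal_tabulate_samplePoint_card_le hmeas (hX.half_mul_le_card hd)
    (ε := 1 / 3) (by norm_num) (by norm_num) N
  have hthreshold : (1 - 1 / 3) * (N * (α / 2)) = α * N / 3 := by ring
  have hexponent : (1 / 3) ^ 2 / 2 * (N * (α / 2)) = α * N / 36 := by ring
  rw [hthreshold, hexponent] at hchernoff
  refine toOuterMeasure_le_ofReal ?_
  convert hchernoff
  exact Iff.rfl

theorem toOuterMeasure_signMatrix_not_preservesSqNorm_le {N c : ℕ} (hc : c ≠ 0)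
    (x : Fin N → EuclideanSpace ℝ (Fin d)) :
    (law X (signMatrix c)).toOuterMeasure
        {G | ¬ ∀ i j, PreservesSqNorm (1 / 10) (Matrix.of G) (x i - x j)} ≤
      ENNReal.ofReal (N ^ 2 * (2 * Real.exp (-(c / 3200)))) := by
  have hunion := measureReal_signMatrix_not_preservesSqNorm_le (X := X) hc
    (fun p : Fin N × Fin N => x p.1 - x p.2) (ε := 1 / 10) (by norm_num) (by norm_num)
  simp only [Prod.forall] at hunion
  refine toOuterMeasure_le_ofReal (hunion.trans_eq ?_)
  rw [Fintype.card_prod, Fintype.card_fin]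
  push_cast
  ring_nf

theorem ofReal_one_sub_le_toOuterMeasure_samplePostProcess (hK : 18 * 3200 ≤ K) (hα : 0 < α)
    (hα2 : α ≤ 1 / 2) (hδ : 0 < δ) (hδ1 : δ ≤ 1) (hd : d ≠ 0) (hX : HasInliers X α μ) :
    ENNReal.ofReal (1 - δ) ≤ (law X (samplePostProcess K α δ)).toOuterMeasure
      {o | ∀ L, Maximal (o.IsClusterSet α) L →
        ∃ i ∈ L, ‖WithLp.toLp 2 (o.pts i) - μ‖ ^ 2 ≤ 100 * d} := by
  have hsample := (toOuterMeasure_tabulate_samplePoint_card_le hX hd (sampleSize α δ)).trans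
    (ENNReal.ofReal_le_ofReal (exp_neg_sampleSize_le hα hδ))
  have hsketch (pts : Fin (sampleSize α δ) → Fin d → ℝ) :=
    (toOuterMeasure_signMatrix_not_preservesSqNorm_le (X := X)
      (sketchSize_ne_zero (K := K) (by omega) hα hα2 hδ hδ1) fun i => WithLp.toLp 2 (pts i)).trans
    (ENNReal.ofReal_le_ofReal (sampleSize_sq_mul_exp_neg_sketchSize_le hK hα hα2 hδ hδ1))
  have hN : (0 : ℝ) < sampleSize α δ := by
    exact_mod_cast Nat.pos_of_ne_zero (sampleSize_ne_zero hα hδ hδ1)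
  have hδ2 : ENNReal.ofReal (δ / 2) + (ENNReal.ofReal (δ / 2) + 0) = ENNReal.ofReal δ := by
    rw [add_zero, ← ENNReal.ofReal_add (by positivity) (by positivity), add_halves]
  rw [ENNReal.ofReal_sub 1 hδ.le, ENNReal.ofReal_one, ← hδ2, law_samplePostProcess]
  refine one_sub_le_toOuterMeasure <| toOuterMeasure_bind_le hsample fun pts hpts =>
    toOuterMeasure_bind_le (hsketch pts) fun G hG => le_of_eq <|
      (ensures_clusterPhase α _ _ pts G).toOuterMeasure_law_eq_zero ?_
  rintro o ⟨sel, rfl, -⟩ hbad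
  exact hbad fun L hL => Outcome.exists_norm_sub_sq_le (mul_pos hα hN) (not_le.1 hpts).le
    (not_not.1 hG) hL

theorem toOuterMeasure_exec {A : Type} (p : Prog ℝ n d A) (s : Set A) :
    (p.exec X).toOuterMeasure {o | o.1 ∈ s} = (law X p).toOuterMeasure s :=
  (PMF.toOuterMeasure_map_apply _ _ _).symm

end Prog

theorem le_div_sqrt_div_sqrt {a t C D α : ℝ} (ha : 0 ≤ a) (hC : 0 < C) (hα : 0 < α) (hD : 0 < D)
    (hαD : α ≤ 1 / (C * D)) (ht : t ^ 2 ≤ a ^ 2 * D) : t ≤ a / √C / √α := by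
  refine (abs_le_of_sq_le_sq' ?_ (by positivity)).2
  calc t ^ 2 ≤ a ^ 2 * D := ht
    _ ≤ a ^ 2 * (1 / (C * α)) := by
      gcongr
      exact le_one_div_mul_comm hα hD hC hαD
    _ = (a / √C / √α) ^ 2 := by
      rw [div_pow, div_pow, Real.sq_sqrt hC.le, Real.sq_sqrt hα.le]
      field_simp

theorem propositionA1 :
    ∃ K₀ : ℕ, ∀ C : ℝ, 0 < C → ∃ A : ℝ, 0 < A ∧ ∀ K : ℕ, K₀ ≤ K → ∃ B : ℝ, 0 < B ∧
      ∀ (d n : ℕ) [NeZero n], 1 ≤ d →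
      ∀ (X : Fin n → EuclideanSpace ℝ (Fin d)) (μ : EuclideanSpace ℝ (Fin d)) (α δ : ℝ),
        0 < α → α ≤ 1 / 2 → α ≤ 1 / (C * d) → 0 < δ → δ < 1 → HasInliers X α μ →
        -- in every execution: a maximal set is returned, maximal sets are small, the time is bounded
        (∀ o ∈ ((samplePostProcess K α δ).exec X).support,
          Maximal (o.1.IsClusterSet α) o.1.returned ∧
          (∀ L, Maximal (o.1.IsClusterSet α) L → (L.card : ℝ) ≤ 3 / α) ∧
          (o.2 : ℝ) ≤ B * (1 / α ^ 2 * Real.log (1 / (α * δ)) ^ 4)) ∧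
        -- with probability at least `1 - δ`, every maximal set has a point close to `μ`
        ENNReal.ofReal (1 - δ) ≤ ((samplePostProcess K α δ).exec X).toOuterMeasure
          {o | ∀ L, Maximal (o.1.IsClusterSet α) L →
            ∃ i ∈ L, ‖WithLp.toLp 2 (o.1.pts i) - μ‖ ≤ A / Real.sqrt α} := by
  refine ⟨18 * 3200, fun C hC => ⟨10 / √C, by positivity, fun K hK =>
    ⟨3800 * (K + 2) * (38 + 2 / C), by positivity, ?_⟩⟩⟩
  intro d n _ hd X μ α δ hα hα2 hαd hδ hδ1 hX
  have hd0 : d ≠ 0 := by omega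
  refine ⟨fun o ho => ?_, ?_⟩
  · obtain ⟨⟨hN, hmax⟩, hsteps⟩ := Prog.ensures_samplePostProcess K α δ o ho
    refine ⟨hmax, fun L hL => hL.1.card_le hα (hN ▸ sampleSize_ne_zero hα hδ hδ1.le), ?_⟩
    exact (Nat.cast_le.2 hsteps).trans
      (stepBound_sampleSize_sketchSize_le hC (by omega) hd0 hα hα2 hαd hδ hδ1.le)
  · have hsuccess := Prog.ofReal_one_sub_le_toOuterMeasure_samplePostProcess hK hα hα2 hδ hδ1.le
      hd0 hX
    rw [← Prog.toOuterMeasure_exec] at hsuccess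
    exact hsuccess.trans <| measure_mono fun o ho L hL =>
      let ⟨i, hi, hle⟩ := ho L hL
      ⟨i, hi, le_div_sqrt_div_sqrt (by norm_num) hC hα (by positivity) hαd
        (hle.trans_eq (by norm_num))⟩
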